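/- Let $\mathcal C$ be a non-degenerate braided fusion category over $\mathbb C$ with braiding $\beta$, and let $(A,m,i)$ be a connected étale (i.e. commutative and separable) algebra in $\mathcal C$, connected meaning $\dim \mathcal C(1,A)=1$. Let $\mathcal C_A$ be the monoidal category of right $A$-modules $(M,r)$ with tensor product $M\otimes_A N$, the quotient $\pi_{M,N}\colon M\otimes N\to M\otimes_A N$ which identifies the action of $A$ on $M$ with the action $r_N\circ\beta_{A,N}$ of $A$ on $N$, and let $\mathcal C_A^{\mathrm{loc}}\subset\mathcal C_A$ be the full monoidal subcategory of local modules, those with $r\circ\beta_{A,M}\circ\beta_{M,A}=r$; it is braided by the braiding induced by $\beta$. For a $\mathbb C$-linear braided monoidal category $\mathcal D$ let $\underline{\mathsf{Aut}}^{\mathsf{br}}_\otimes(\mathcal D)$ be the categorical group (a monoidal category under composition) of $\mathbb C$-linear braided monoidal autoequivalences of $\mathcal D$ and monoidal natural isomorphisms. For $(\alpha,\psi^\alpha)\in\underline{\mathsf{Aut}}^{\mathsf{br}}_\otimes(\mathcal C)$ the object $\alpha(A)$ is an algebra with multiplication $\alpha(m)\circ\psi^\alpha_{A,A}$ and unit induced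 by $\alpha(i)$. Let $\underline{\mathsf{Stab}}^{\mathsf{br}}_\otimes(A)$ be the full categorical subgroup of those $\alpha$ with $\alpha(A)\cong A$ as algebras, and let $\underline{\mathsf{Aut}}^{\mathsf{br}}_\otimes(\mathcal C|A)$ be the categorical group whose objects are pairs $(\alpha,\lambda^\alpha)$ of $\alpha\in\underline{\mathsf{Aut}}^{\mathsf{br}}_\otimes(\mathcal C)$ and an algebra isomorphism $\lambda^\alpha\colon\alpha(A)\to A$, whose morphisms $(\alpha,\lambda^\alpha)\to(\gamma,\lambda^\gamma)$ are the monoidal natural isomorphisms $\eta\colon\alpha\Rightarrow\gamma$ with $\lambda^\gamma\circ\eta_A=\lambda^\alpha$, and whose composition is $(\alpha,\lambda^\alpha)\circ(\gamma,\lambda^\gamma)=(\alpha\circ\gamma,\lambda^\alpha\circ\alpha(\lambda^\gamma))$. 1. For every pair $(\alpha,\lambda^\alpha)$ and every local module $(M,r)$ the twisted module $\bigl(\alpha(M),\ \alpha(r)\circ\psi^\alpha_{M,A}\circ(\mathrm{id}_{\alpha(M)}\otimes(\lambda^\alpha)^{-1})\bigr)$ is local. There is a strong monoidal functor $$\underline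 F_A\colon\underline{\mathsf{Aut}}^{\mathsf{br}}_\otimes(\mathcal C|A)\to\underline{\mathsf{Aut}}^{\mathsf{br}}_\otimes(\mathcal C_A^{\mathrm{loc}})$$ which, up to natural isomorphisms that are compatible with all the data that follow, sends $(\alpha,\lambda^\alpha)$ to this twisting functor $(M,r)\mapsto\alpha(M)$, $f\mapsto\alpha(f)$, with the tensorator induced by $\psi^\alpha$ (that is, $\mu_{M,N}\circ\pi_{\alpha(M),\alpha(N)}=\alpha(\pi_{M,N})\circ\psi^\alpha_{M,N}$) and the unit constraint $(\lambda^\alpha)^{-1}\colon A\to\alpha(A)$; which sends $\eta$ to the natural isomorphism with components $\eta_M$; and whose own monoidal constraints are given by the identities of $\alpha(\gamma(M))=(\alpha\circ\gamma)(M)$ and of $M$. 2. Let $G$ be a group and let $(\underline\rho,\mu)\colon\underline G\to\underline{\mathsf{Aut}}^{\mathsf{br}}_\otimes(\mathcal C)$ be a categorical action, i.e. a strong monoidal functor from $G$ regarded as a discrete monoidal category, such that $\underline\rho(g)\in\underline{\mathsf{Stab}}^{\mathsf{br}}_\otimes(A)$ for all $g$; write $g$ for $\underline\rho(g)$. The lifts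 of $(\underline\rho,\mu)$ to $\underline{\mathsf{Aut}}^{\mathsf{br}}_\otimes(\mathcal C|A)$, i.e. the strong monoidal functors $\underline G\to\underline{\mathsf{Aut}}^{\mathsf{br}}_\otimes(\mathcal C|A)$ whose composite with the forgetful monoidal functor $(\alpha,\lambda^\alpha)\mapsto\alpha$ equals $(\underline\rho,\mu)$, are in bijection with the $G$-equivariant algebra structures on $A$, i.e. the families of algebra isomorphisms $\lambda^g\colon g(A)\to A$, $g\in G$, with $\lambda^g\circ g(\lambda^h)=\lambda^{gh}\circ\mu^A_{g,h}$ for all $g,h\in G$. The bijection sends a lift $g\mapsto(g,\lambda^g)$ to the family $(\lambda^g)_{g\in G}$. 3. Consequently every $G$-equivariant algebra structure $\lambda$ on $A$ induces a categorical action $\underline G\to\underline{\mathsf{Aut}}^{\mathsf{br}}_\otimes(\mathcal C_A^{\mathrm{loc}})$, the composite of the corresponding lift with $\underline F_A$: up to the same identifications, $g$ acts by twisting with $(g,\lambda^g)$, and the monoidal constraints are those of $\underline\rho$ at the objects underlying local modules. -/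

import Mathlib

open CategoryTheory MonoidalCategory Limits MonObj

universe v u w

set_option linter.unusedSectionVars false

namespace Condensation

section Modules

variable {C : Type u} [Category.{v} C] [MonoidalCategory C]

/-- Right modules over an algebra object. -/
structure RMod (A : C) [MonObj A] where
  X : C
  act : X ⊗ A ⟶ X
  act_one : X ◁ η[A] ≫ act = (ρ_ X).hom
  act_mul : X ◁ μ[A] ≫ act = (α_ X A A).inv ≫ act ▷ A ≫ act

namespace RMod

variable {A : C} [MonObj A]

/-- Morphisms of right modules. -/
@[ext]
structure Hom (M N : RMod A) where
  hom : M.X ⟶ N.X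
  comm : M.act ≫ hom = hom ▷ A ≫ N.act

instance : Category (RMod A) where
  Hom M N := Hom M N
  id M := ⟨𝟙 M.X, by simp⟩
  comp f g := ⟨f.hom ≫ g.hom, by rw [← Category.assoc, f.comm, Category.assoc, g.comm]; simp⟩

@[ext]
lemma hom_ext {M N : RMod A} {f g : M ⟶ N} (h : f.hom = g.hom) : f = g := Hom.ext h

@[simp] lemma id_hom (M : RMod A) : Hom.hom (𝟙 M) = 𝟙 M.X := rfl
@[simp] lemma comp_hom {M N P : RMod A} (f : M ⟶ N) (g : N ⟶ P) :
    Hom.hom (f ≫ g) = f.hom ≫ g.hom := rfl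

/-- An isomorphism of underlying objects which is a module map. -/
@[simps]
def isoMk {M N : RMod A} (e : M.X ≅ N.X) (h : M.act ≫ e.hom = e.hom ▷ A ≫ N.act) : M ≅ N where
  hom := ⟨e.hom, h⟩
  inv := ⟨e.inv, by
    rw [← cancel_mono e.hom, Category.assoc, Category.assoc, h, e.inv_hom_id, Category.comp_id,
      ← Category.assoc, ← comp_whiskerRight, e.inv_hom_id]; simp⟩

section Linear

variable [Preadditive C] [Linear ℂ C] [MonoidalPreadditive C] [MonoidalLinear ℂ C]

/-- The module maps form a linear subspace of all morphisms of underlying objects. -/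
def homSubmodule (M N : RMod A) : Submodule ℂ (M.X ⟶ N.X) where
  carrier := {f | M.act ≫ f = f ▷ A ≫ N.act}
  zero_mem' := by simp
  add_mem' {f g} hf hg := by
    simp only [Set.mem_ofPred_eq] at *
    simp [hf, hg]
  smul_mem' c f hf := by
    simp only [Set.mem_ofPred_eq] at *
    simp [hf]

/-- Morphisms of modules as elements of the subspace of module maps. -/
def homEquiv (M N : RMod A) : (M ⟶ N) ≃ homSubmodule M N where
  toFun f := ⟨f.hom, f.comm⟩
  invFun f := ⟨f.1, f.2⟩

instance (M N : RMod A) : AddCommGroup (M ⟶ N) := (homEquiv M N).addCommGroup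

instance (M N : RMod A) : Module ℂ (M ⟶ N) := (homEquiv M N).module ℂ

lemma add_hom {M N : RMod A} (f g : M ⟶ N) : Hom.hom (f + g) = f.hom + g.hom := rfl
lemma smul_hom {M N : RMod A} (c : ℂ) (f : M ⟶ N) : Hom.hom (c • f) = c • f.hom := rfl

instance : Preadditive (RMod A) where
  add_comp _ _ _ f f' g := by ext; simp [add_hom]
  comp_add _ _ _ f g g' := by ext; simp [add_hom]

instance : Linear ℂ (RMod A) where
  smul_comp _ _ _ c f g := by ext; simp [smul_hom]
  comp_smul _ _ _ f c g := by ext; simp [smul_hom]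

end Linear

section Braided

variable [BraidedCategory C]

/-- The left action on a right module obtained from the half-braiding `β_{A,-}`. -/
def lact (N : RMod A) : A ⊗ N.X ⟶ N.X := (β_ A N.X).hom ≫ N.act

/-- Local (dyslectic) modules: `r ∘ β_{A,M} ∘ β_{M,A} = r`. -/
def IsLocal (M : RMod A) : Prop :=
  (β_ M.X A).hom ≫ (β_ A M.X).hom ≫ M.act = M.act

lemma one_lact (N : RMod A) : η[A] ▷ N.X ≫ N.lact = (λ_ N.X).hom := by
  simp [lact, N.act_one]

lemma act_act (N : RMod A) : N.act ▷ A ≫ N.act = (α_ N.X A A).hom ≫ N.X ◁ μ[A] ≫ N.act := by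
  simp [N.act_mul]

lemma hom_lact {M N : RMod A} (f : M ⟶ N) : M.lact ≫ f.hom = A ◁ f.hom ≫ N.lact := by
  simp [lact, f.comm]

lemma lact_act [IsCommMonObj A] (N : RMod A) :
    N.lact ▷ A ≫ N.act = (α_ A N.X A).hom ≫ A ◁ N.act ≫ N.lact := by
  have h : (β_ A A).hom ≫ μ[A] = μ[A] := IsCommMonObj.mul_comm A
  have e : A ◁ N.act ≫ N.lact = (β_ A (N.X ⊗ A)).hom ≫ N.act ▷ A ≫ N.act := by
    simp [lact]
  rw [e, act_act, lact, comp_whiskerRight, Category.assoc, act_act]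
  simp only [BraidedCategory.braiding_tensor_right_hom, Category.assoc, Iso.inv_hom_id_assoc,
    Iso.hom_inv_id_assoc]
  rw [← MonoidalCategory.whiskerLeft_comp_assoc, h]

lemma mul_lact [IsCommMonObj A] (N : RMod A) :
    μ[A] ▷ N.X ≫ N.lact = (α_ A A N.X).hom ≫ A ◁ N.lact ≫ N.lact := by
  have h : (β_ A A).hom ≫ μ[A] = μ[A] := IsCommMonObj.mul_comm A
  have e : A ◁ N.lact ≫ N.lact =
      (β_ A (A ⊗ N.X)).hom ≫ (β_ A N.X).hom ▷ A ≫ N.act ▷ A ≫ N.act := by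
    rw [← BraidedCategory.braiding_naturality_right_assoc]
    simp [lact]
  rw [e, act_act]
  conv_lhs => rw [← h]
  simp only [comp_whiskerRight, lact, Category.assoc, BraidedCategory.braiding_naturality_left_assoc,
    BraidedCategory.braiding_tensor_left_hom, BraidedCategory.braiding_tensor_right_hom,
    Iso.hom_inv_id_assoc]

section Tensor

variable [HasCoequalizers C] [∀ Z : C, PreservesColimitsOfShape WalkingParallelPair (tensorLeft Z)]

/-- The object underlying the relative tensor product `M ⊗_A N`: the coequalizer of the action of
`A` on `M` and the action of `A` on `N` through the half-braiding. -/
noncomputable def tensX (M N : RMod A) : C :=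
  coequalizer (M.act ▷ N.X) ((α_ M.X A N.X).hom ≫ M.X ◁ N.lact)

/-- The canonical projection `M ⊗ N ⟶ M ⊗_A N`. -/
noncomputable def projX (M N : RMod A) : M.X ⊗ N.X ⟶ tensX M N := coequalizer.π _ _

lemma projX_balanced (M N : RMod A) :
    M.act ▷ N.X ≫ projX M N = (α_ M.X A N.X).hom ≫ M.X ◁ N.lact ≫ projX M N := by
  have := coequalizer.condition (M.act ▷ N.X) ((α_ M.X A N.X).hom ≫ M.X ◁ N.lact)
  rwa [Category.assoc] at this

lemma epi_projX_whiskerRight (M N : RMod A) (Z : C) : Epi (projX M N ▷ Z) :=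
  inferInstanceAs (Epi ((tensorRight Z).map (coequalizer.π _ _)))

variable [IsCommMonObj A]

/-- The right action on `M ⊗_A N`, induced by the action on `N`. -/
noncomputable def tensAct (M N : RMod A) : tensX M N ⊗ A ⟶ tensX M N :=
  Cofork.IsColimit.desc (isColimitOfHasCoequalizerOfPreservesColimit (tensorRight A)
    (M.act ▷ N.X) ((α_ M.X A N.X).hom ≫ M.X ◁ N.lact))
    ((α_ M.X N.X A).hom ≫ M.X ◁ N.act ≫ projX M N) (by
    have h := lact_act N
    have b := projX_balanced M N
    change (M.act ▷ N.X) ▷ A ≫ (α_ M.X N.X A).hom ≫ M.X ◁ N.act ≫ projX M N =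
      ((α_ M.X A N.X).hom ≫ M.X ◁ N.lact) ▷ A ≫ (α_ M.X N.X A).hom ≫ M.X ◁ N.act ≫ projX M N
    calc
      _ = (α_ (M.X ⊗ A) N.X A).hom ≫ (M.X ⊗ A) ◁ N.act ≫ M.act ▷ N.X ≫ projX M N := by
        rw [whisker_exchange_assoc]; simp
      _ = (α_ (M.X ⊗ A) N.X A).hom ≫ (α_ M.X A (N.X ⊗ A)).hom ≫
          M.X ◁ (A ◁ N.act ≫ N.lact) ≫ projX M N := by
        rw [b]; simp
      _ = (α_ (M.X ⊗ A) N.X A).hom ≫ (α_ M.X A (N.X ⊗ A)).hom ≫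
          M.X ◁ ((α_ A N.X A).inv ≫ N.lact ▷ A ≫ N.act) ≫ projX M N := by
        rw [h]; simp
      _ = _ := by simp)

lemma projX_tensAct (M N : RMod A) :
    projX M N ▷ A ≫ tensAct M N = (α_ M.X N.X A).hom ≫ M.X ◁ N.act ≫ projX M N :=
  Cofork.IsColimit.π_desc' (isColimitOfHasCoequalizerOfPreservesColimit (tensorRight A)
    (M.act ▷ N.X) ((α_ M.X A N.X).hom ≫ M.X ◁ N.lact)) _ _

/-- The relative tensor product `M ⊗_A N`. -/
noncomputable def tens (M N : RMod A) : RMod A where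
  X := tensX M N
  act := tensAct M N
  act_one := by
    have := epi_projX_whiskerRight M N (𝟙_ C)
    rw [← cancel_epi (projX M N ▷ 𝟙_ C), ← whisker_exchange_assoc, projX_tensAct,
      associator_naturality_right_assoc, ← MonoidalCategory.whiskerLeft_comp_assoc, N.act_one]
    simp
  act_mul := by
    have := epi_projX_whiskerRight M N (A ⊗ A)
    rw [← cancel_epi (projX M N ▷ (A ⊗ A)), ← whisker_exchange_assoc, projX_tensAct,
      associator_naturality_right_assoc, ← MonoidalCategory.whiskerLeft_comp_assoc, N.act_mul,
      whiskerRight_tensor]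
    simp only [Category.assoc, Iso.hom_inv_id_assoc, ← comp_whiskerRight_assoc, projX_tensAct]
    simp [projX_tensAct]

/-- The canonical projection `M ⊗ N ⟶ M ⊗_A N`. -/
noncomputable def proj (M N : RMod A) : M.X ⊗ N.X ⟶ (tens M N).X := projX M N

lemma proj_balanced (M N : RMod A) :
    M.act ▷ N.X ≫ proj M N = (α_ M.X A N.X).hom ≫ M.X ◁ N.lact ≫ proj M N :=
  projX_balanced M N

lemma proj_act (M N : RMod A) :
    proj M N ▷ A ≫ (tens M N).act = (α_ M.X N.X A).hom ≫ M.X ◁ N.act ≫ proj M N :=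
  projX_tensAct M N

/-- Maps out of the relative tensor product. -/
noncomputable def desc {M N : RMod A} {Q : C} (f : M.X ⊗ N.X ⟶ Q)
    (h : M.act ▷ N.X ≫ f = (α_ M.X A N.X).hom ≫ M.X ◁ N.lact ≫ f) : (tens M N).X ⟶ Q :=
  coequalizer.desc f (by rw [h, Category.assoc])

@[simp] lemma proj_desc {M N : RMod A} {Q : C} (f : M.X ⊗ N.X ⟶ Q)
    (h : M.act ▷ N.X ≫ f = (α_ M.X A N.X).hom ≫ M.X ◁ N.lact ≫ f) : proj M N ≫ desc f h = f :=
  coequalizer.π_desc _ _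

@[simp] lemma proj_desc_assoc {M N : RMod A} {Q R : C} (f : M.X ⊗ N.X ⟶ Q)
    (h : M.act ▷ N.X ≫ f = (α_ M.X A N.X).hom ≫ M.X ◁ N.lact ≫ f) (k : Q ⟶ R) :
    proj M N ≫ desc f h ≫ k = f ≫ k := by
  rw [← Category.assoc, proj_desc]

instance (M N : RMod A) : Epi (proj M N) :=
  inferInstanceAs (Epi (coequalizer.π (M.act ▷ N.X) ((α_ M.X A N.X).hom ≫ M.X ◁ N.lact)))

instance (M N : RMod A) (Z : C) : Epi (proj M N ▷ Z) := epi_projX_whiskerRight M N Z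

instance (M N : RMod A) (Z : C) : Epi (Z ◁ proj M N) :=
  inferInstanceAs (Epi ((tensorLeft Z).map (coequalizer.π _ _)))

instance (M N : RMod A) (Z W : C) : Epi ((proj M N ▷ Z) ▷ W) :=
  inferInstanceAs (Epi ((tensorRight Z ⋙ tensorRight W).map (coequalizer.π _ _)))

instance (M N : RMod A) (Z W : C) : Epi ((Z ◁ proj M N) ▷ W) :=
  inferInstanceAs (Epi ((tensorLeft Z ⋙ tensorRight W).map (coequalizer.π _ _)))

instance (M N : RMod A) (Z W : C) : Epi (W ◁ (proj M N ▷ Z)) :=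
  inferInstanceAs (Epi ((tensorRight Z ⋙ tensorLeft W).map (coequalizer.π _ _)))

instance (M N : RMod A) (Z W : C) : Epi (W ◁ (Z ◁ proj M N)) :=
  inferInstanceAs (Epi ((tensorLeft Z ⋙ tensorLeft W).map (coequalizer.π _ _)))

/-- Maps out of `(M ⊗_A N) ⊗ Z`. -/
noncomputable def descR {M N : RMod A} {Z Q : C} (f : (M.X ⊗ N.X) ⊗ Z ⟶ Q)
    (h : (M.act ▷ N.X) ▷ Z ≫ f = ((α_ M.X A N.X).hom ≫ M.X ◁ N.lact) ▷ Z ≫ f) :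
    (tens M N).X ⊗ Z ⟶ Q :=
  Cofork.IsColimit.desc (isColimitOfHasCoequalizerOfPreservesColimit (tensorRight Z)
    (M.act ▷ N.X) ((α_ M.X A N.X).hom ≫ M.X ◁ N.lact)) f h

@[simp] lemma proj_descR {M N : RMod A} {Z Q : C} (f : (M.X ⊗ N.X) ⊗ Z ⟶ Q)
    (h : (M.act ▷ N.X) ▷ Z ≫ f = ((α_ M.X A N.X).hom ≫ M.X ◁ N.lact) ▷ Z ≫ f) :
    proj M N ▷ Z ≫ descR f h = f :=
  Cofork.IsColimit.π_desc' (isColimitOfHasCoequalizerOfPreservesColimit (tensorRight Z)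
    (M.act ▷ N.X) ((α_ M.X A N.X).hom ≫ M.X ◁ N.lact)) f h

/-- Maps out of `Z ⊗ (M ⊗_A N)`. -/
noncomputable def descL {M N : RMod A} {Z Q : C} (f : Z ⊗ (M.X ⊗ N.X) ⟶ Q)
    (h : Z ◁ (M.act ▷ N.X) ≫ f = Z ◁ ((α_ M.X A N.X).hom ≫ M.X ◁ N.lact) ≫ f) :
    Z ⊗ (tens M N).X ⟶ Q :=
  Cofork.IsColimit.desc (isColimitOfHasCoequalizerOfPreservesColimit (tensorLeft Z)
    (M.act ▷ N.X) ((α_ M.X A N.X).hom ≫ M.X ◁ N.lact)) f h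

@[simp] lemma proj_descL {M N : RMod A} {Z Q : C} (f : Z ⊗ (M.X ⊗ N.X) ⟶ Q)
    (h : Z ◁ (M.act ▷ N.X) ≫ f = Z ◁ ((α_ M.X A N.X).hom ≫ M.X ◁ N.lact) ≫ f) :
    Z ◁ proj M N ≫ descL f h = f :=
  Cofork.IsColimit.π_desc' (isColimitOfHasCoequalizerOfPreservesColimit (tensorLeft Z)
    (M.act ▷ N.X) ((α_ M.X A N.X).hom ≫ M.X ◁ N.lact)) f h

/-- The left action on `M ⊗_A N` is the one induced by the left action on `M`. -/
lemma proj_lact (M N : RMod A) :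
    A ◁ proj M N ≫ (tens M N).lact = (α_ A M.X N.X).inv ≫ M.lact ▷ N.X ≫ proj M N := by
  have b := proj_balanced M N
  have e : A ◁ proj M N ≫ (tens M N).lact =
      (β_ A (M.X ⊗ N.X)).hom ≫ proj M N ▷ A ≫ (tens M N).act := by simp [lact]
  rw [e, proj_act]
  conv_rhs => rw [lact, comp_whiskerRight, Category.assoc, b]
  simp [lact]

lemma tensMap_balanced {M M' N N' : RMod A} (f : M ⟶ M') (g : N ⟶ N') :
    M.act ▷ N.X ≫ (f.hom ⊗ₘ g.hom) ≫ proj M' N' =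
      (α_ M.X A N.X).hom ≫ M.X ◁ N.lact ≫ (f.hom ⊗ₘ g.hom) ≫ proj M' N' := by
  have h1 := proj_balanced M' N'
  have h2 := hom_lact g
  have h3 := f.comm
  calc
    _ = ((f.hom ▷ A) ⊗ₘ g.hom) ≫ M'.act ▷ N'.X ≫ proj M' N' := by
      simp only [MonoidalCategory.tensorHom_def', Category.assoc, ← comp_whiskerRight_assoc, ← h3,
        whisker_exchange_assoc]
    _ = (α_ M.X A N.X).hom ≫ (f.hom ⊗ₘ (N.lact ≫ g.hom)) ≫ proj M' N' := by
      rw [h1, h2]; simp [MonoidalCategory.tensorHom_def]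
    _ = _ := by simp [MonoidalCategory.tensorHom_def']

/-- The functoriality of the relative tensor product. -/
noncomputable def tensMap {M M' N N' : RMod A} (f : M ⟶ M') (g : N ⟶ N') :
    tens M N ⟶ tens M' N' where
  hom := desc ((f.hom ⊗ₘ g.hom) ≫ proj M' N') (tensMap_balanced f g)
  comm := by
    rw [← cancel_epi (proj M N ▷ A), ← Category.assoc, proj_act, ← comp_whiskerRight_assoc,
      proj_desc]
    simp only [comp_whiskerRight, Category.assoc, proj_act, proj_desc,
      MonoidalCategory.tensorHom_def]
    rw [whisker_exchange_assoc, ← MonoidalCategory.whiskerLeft_comp_assoc, g.comm]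
    simp

@[simp] lemma proj_tensMap {M M' N N' : RMod A} (f : M ⟶ M') (g : N ⟶ N') :
    proj M N ≫ (tensMap f g).hom = (f.hom ⊗ₘ g.hom) ≫ proj M' N' :=
  proj_desc _ (tensMap_balanced f g)

@[simp] lemma proj_tensMap_assoc {M M' N N' : RMod A} (f : M ⟶ M') (g : N ⟶ N') {Q : C}
    (k : (tens M' N').X ⟶ Q) :
    proj M N ≫ (tensMap f g).hom ≫ k = (f.hom ⊗ₘ g.hom) ≫ proj M' N' ≫ k := by
  rw [← Category.assoc, proj_tensMap, Category.assoc]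

lemma tens_ext {M N P : RMod A} {f g : tens M N ⟶ P}
    (h : proj M N ≫ f.hom = proj M N ≫ g.hom) : f = g := by
  ext; exact (cancel_epi _).1 h

lemma tens_ext₃ {M N P Q : RMod A} {f g : tens (tens M N) P ⟶ Q}
    (h : proj M N ▷ P.X ≫ proj (tens M N) P ≫ f.hom =
      proj M N ▷ P.X ≫ proj (tens M N) P ≫ g.hom) : f = g :=
  tens_ext ((cancel_epi _).1 h)

variable (A) in
/-- The regular module, which is the tensor unit. -/
abbrev regular : RMod A where
  X := A
  act := μ[A]
  act_one := by simp
  act_mul := by simp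

lemma regular_lact : (regular A).lact = μ[A] := IsCommMonObj.mul_comm A

lemma act_balanced (M : RMod A) : M.act ▷ (regular A).X ≫ M.act =
    (α_ M.X A (regular A).X).hom ≫ M.X ◁ (regular A).lact ≫ M.act := by
  rw [regular_lact]; exact M.act_act

/-- The left unitor, given by the left action. -/
noncomputable def leftUnitorHom (M : RMod A) : tens (regular A) M ⟶ M where
  hom := desc M.lact (mul_lact M)
  comm := by
    rw [← cancel_epi (proj _ M ▷ A), ← Category.assoc, proj_act, ← comp_whiskerRight_assoc,
      proj_desc]
    simp [lact_act]

/-- The right unitor, given by the action. -/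
noncomputable def rightUnitorHom (M : RMod A) : tens M (regular A) ⟶ M where
  hom := desc M.act (act_balanced M)
  comm := by
    rw [← cancel_epi (proj M _ ▷ A), ← Category.assoc, proj_act, ← comp_whiskerRight_assoc,
      proj_desc]
    simp [act_act]

@[simp] lemma proj_leftUnitorHom (M : RMod A) :
    proj (regular A) M ≫ (leftUnitorHom M).hom = M.lact := proj_desc _ (mul_lact M)

@[simp] lemma proj_rightUnitorHom (M : RMod A) :
    proj M (regular A) ≫ (rightUnitorHom M).hom = M.act := proj_desc _ (act_balanced M)

/-- The left unitor. -/
noncomputable def lUnitor (M : RMod A) : tens (regular A) M ≅ M :=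
  isoMk { hom := (leftUnitorHom M).hom
          inv := (λ_ M.X).inv ≫ η[A] ▷ M.X ≫ proj (regular A) M
          hom_inv_id := by
            have b := proj_balanced (regular A) M
            rw [← cancel_epi (proj _ M), ← Category.assoc, proj_leftUnitorHom]
            have : M.lact ≫ (λ_ M.X).inv ≫ η[A] ▷ M.X =
              (λ_ _).inv ≫ η[A] ▷ (A ⊗ M.X) ≫ A ◁ M.lact := by
              rw [← whisker_exchange]; simp
            rw [reassoc_of% this]
            have b' : A ◁ M.lact ≫ proj (regular A) M =
              (α_ A A M.X).inv ≫ μ[A] ▷ M.X ≫ proj (regular A) M := by rw [b]; simp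
            rw [b']
            have : (λ_ (A ⊗ M.X)).inv ≫ η[A] ▷ (A ⊗ M.X) ≫ (α_ A A M.X).inv ≫ μ[A] ▷ M.X =
              𝟙 _ := by
              have := MonObj.one_mul A
              rw [whiskerRight_tensor]
              simp [← comp_whiskerRight]
            rw [reassoc_of% this]; simp
          inv_hom_id := by
            simp only [Category.assoc, proj_leftUnitorHom]
            rw [one_lact]; simp } (leftUnitorHom M).comm

/-- The right unitor. -/
noncomputable def rUnitor (M : RMod A) : tens M (regular A) ≅ M :=
  isoMk { hom := (rightUnitorHom M).hom
          inv := (ρ_ M.X).inv ≫ M.X ◁ η[A] ≫ proj M (regular A)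
          hom_inv_id := by
            have b := proj_balanced M (regular A)
            rw [← cancel_epi (proj M _), ← Category.assoc, proj_rightUnitorHom]
            have : M.act ≫ (ρ_ M.X).inv ≫ M.X ◁ η[A] =
              (ρ_ _).inv ≫ (M.X ⊗ A) ◁ η[A] ≫ M.act ▷ A := by
              rw [whisker_exchange]; simp
            rw [reassoc_of% this, b, regular_lact]
            simp [← MonoidalCategory.whiskerLeft_comp_assoc]
          inv_hom_id := by
            simp only [Category.assoc, proj_rightUnitorHom]
            rw [M.act_one]; simp } (rightUnitorHom M).comm

@[simp] lemma proj_lUnitor (M : RMod A) :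
    proj (regular A) M ≫ (lUnitor M).hom.hom = M.lact := proj_leftUnitorHom M

@[simp] lemma proj_rUnitor (M : RMod A) :
    proj M (regular A) ≫ (rUnitor M).hom.hom = M.act := proj_rightUnitorHom M

/-- Descending `(M ⊗ N) ⊗ P ⟶ M ⊗_A (N ⊗_A P)` in the first two variables. -/
noncomputable def assocHomAux (M N P : RMod A) : (tens M N).X ⊗ P.X ⟶ (tens M (tens N P)).X :=
  descR ((α_ M.X N.X P.X).hom ≫ M.X ◁ proj N P ≫ proj M (tens N P)) (by
    have b := proj_balanced M (tens N P)
    have l := proj_lact N P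
    calc
      _ = (α_ (M.X ⊗ A) N.X P.X).hom ≫ (M.X ⊗ A) ◁ proj N P ≫ M.act ▷ _ ≫
          proj M (tens N P) := by rw [whisker_exchange_assoc]; simp
      _ = (α_ (M.X ⊗ A) N.X P.X).hom ≫ (α_ M.X A _).hom ≫
          M.X ◁ (A ◁ proj N P ≫ (tens N P).lact) ≫ proj M (tens N P) := by rw [b]; simp
      _ = _ := by rw [l]; simp)

@[simp] lemma proj_assocHomAux (M N P : RMod A) : proj M N ▷ P.X ≫ assocHomAux M N P =
    (α_ M.X N.X P.X).hom ≫ M.X ◁ proj N P ≫ proj M (tens N P) := proj_descR _ _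

/-- Descending `M ⊗ (N ⊗ P) ⟶ (M ⊗_A N) ⊗_A P` in the last two variables. -/
noncomputable def assocInvAux (M N P : RMod A) : M.X ⊗ (tens N P).X ⟶ (tens (tens M N) P).X :=
  descL ((α_ M.X N.X P.X).inv ≫ proj M N ▷ P.X ≫ proj (tens M N) P) (by
    have b := proj_balanced (tens M N) P
    have l := proj_act M N
    calc
      _ = (α_ M.X (N.X ⊗ A) P.X).inv ≫ (α_ M.X N.X A).inv ▷ P.X ≫
          ((α_ M.X N.X A).hom ≫ M.X ◁ N.act ≫ proj M N) ▷ P.X ≫ proj (tens M N) P := by simp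
      _ = (α_ M.X (N.X ⊗ A) P.X).inv ≫ (α_ M.X N.X A).inv ▷ P.X ≫ (proj M N ▷ A) ▷ P.X ≫
          (α_ _ A P.X).hom ≫ (tens M N).X ◁ P.lact ≫ proj (tens M N) P := by
        rw [← l, comp_whiskerRight_assoc, b]
      _ = _ := by
        rw [associator_naturality_left_assoc, ← whisker_exchange_assoc]
        simp)

@[simp] lemma proj_assocInvAux (M N P : RMod A) : M.X ◁ proj N P ≫ assocInvAux M N P =
    (α_ M.X N.X P.X).inv ≫ proj M N ▷ P.X ≫ proj (tens M N) P := proj_descL _ _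

/-- The associator, as a morphism of underlying objects. -/
noncomputable def assocHom (M N P : RMod A) : (tens (tens M N) P).X ⟶ (tens M (tens N P)).X :=
  desc (assocHomAux M N P) (by
    rw [← cancel_epi ((proj M N ▷ A) ▷ P.X), ← comp_whiskerRight_assoc, proj_act]
    have b := proj_balanced N P
    calc
      _ = (α_ M.X N.X A).hom ▷ P.X ≫ (M.X ◁ N.act) ▷ P.X ≫ proj M N ▷ P.X ≫
          assocHomAux M N P := by simp
      _ = (α_ M.X N.X A).hom ▷ P.X ≫ (α_ M.X (N.X ⊗ A) P.X).hom ≫ M.X ◁ (N.act ▷ P.X ≫ proj N P) ≫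
          proj M (tens N P) := by rw [proj_assocHomAux]; simp
      _ = (α_ (M.X ⊗ N.X) A P.X).hom ≫ (M.X ⊗ N.X) ◁ P.lact ≫ proj M N ▷ P.X ≫
          assocHomAux M N P := by rw [b, proj_assocHomAux]; simp
      _ = _ := by
        rw [associator_naturality_left_assoc, ← whisker_exchange_assoc])

@[simp] lemma proj_assocHom (M N P : RMod A) :
    proj (tens M N) P ≫ assocHom M N P = assocHomAux M N P := proj_desc _ _

@[simp] lemma proj_assocHom_assoc (M N P : RMod A) {Q : C} (k : (tens M (tens N P)).X ⟶ Q) :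
    proj (tens M N) P ≫ assocHom M N P ≫ k = assocHomAux M N P ≫ k := by
  rw [← Category.assoc, proj_assocHom]

/-- The inverse of the associator, as a morphism of underlying objects. -/
noncomputable def assocInv (M N P : RMod A) : (tens M (tens N P)).X ⟶ (tens (tens M N) P).X :=
  desc (assocInvAux M N P) (by
    rw [← cancel_epi ((M.X ⊗ A) ◁ proj N P)]
    have b := proj_balanced M N
    have l := proj_lact N P
    calc
      _ = M.act ▷ _ ≫ M.X ◁ proj N P ≫ assocInvAux M N P := by rw [whisker_exchange_assoc]
      _ = (α_ (M.X ⊗ A) N.X P.X).inv ≫ (M.act ▷ N.X ≫ proj M N) ▷ P.X ≫ proj (tens M N) P := by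
        rw [proj_assocInvAux]; simp
      _ = (α_ M.X A (N.X ⊗ P.X)).hom ≫ M.X ◁ (α_ A N.X P.X).inv ≫ M.X ◁ (N.lact ▷ P.X) ≫
            M.X ◁ proj N P ≫ assocInvAux M N P := by
        rw [b, proj_assocInvAux]; simp
      _ = (α_ M.X A (N.X ⊗ P.X)).hom ≫ M.X ◁ (A ◁ proj N P ≫ (tens N P).lact) ≫
            assocInvAux M N P := by rw [l]; simp
      _ = _ := by simp)

@[simp] lemma proj_assocInv (M N P : RMod A) :
    proj M (tens N P) ≫ assocInv M N P = assocInvAux M N P := proj_desc _ _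

/-- The associator. -/
noncomputable def assoc (M N P : RMod A) : tens (tens M N) P ≅ tens M (tens N P) :=
  isoMk { hom := assocHom M N P
          inv := assocInv M N P
          hom_inv_id := by
            rw [← cancel_epi (proj _ _), ← cancel_epi (proj M N ▷ P.X), proj_assocHom_assoc,
              ← Category.assoc, proj_assocHomAux]
            simp
          inv_hom_id := by
            rw [← cancel_epi (proj _ _), ← cancel_epi (M.X ◁ proj N P), ← Category.assoc (proj _ _),
              proj_assocInv, ← Category.assoc, proj_assocInvAux]
            simp } (by
    change (tens (tens M N) P).act ≫ assocHom M N P =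
      assocHom M N P ▷ A ≫ (tens M (tens N P)).act
    rw [← cancel_epi (proj (tens M N) P ▷ A), ← cancel_epi ((proj M N ▷ P.X) ▷ A)]
    rw [← Category.assoc (proj _ _ ▷ A), proj_act, ← comp_whiskerRight_assoc (proj _ _), proj_assocHom,
      ← comp_whiskerRight_assoc, proj_assocHomAux]
    simp only [Category.assoc, proj_assocHom]
    rw [associator_naturality_left_assoc, ← whisker_exchange_assoc, proj_assocHomAux]
    simp only [comp_whiskerRight, Category.assoc, proj_act]
    rw [associator_naturality_middle_assoc, ← MonoidalCategory.whiskerLeft_comp_assoc, proj_act]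
    simp)

@[simp] lemma assoc_hom_hom (M N P : RMod A) : (assoc M N P).hom.hom = assocHom M N P := rfl

lemma proj_assoc (M N P : RMod A) :
    proj M N ▷ P.X ≫ proj (tens M N) P ≫ (assoc M N P).hom.hom =
      (α_ M.X N.X P.X).hom ≫ M.X ◁ proj N P ≫ proj M (tens N P) := by
  rw [assoc_hom_hom, proj_assocHom, proj_assocHomAux]

noncomputable instance : MonoidalCategoryStruct (RMod A) where
  tensorObj := tens
  tensorHom := tensMap
  whiskerLeft M _ _ f := tensMap (𝟙 M) f
  whiskerRight f N := tensMap f (𝟙 N)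
  tensorUnit := regular A
  associator := assoc
  leftUnitor := lUnitor
  rightUnitor := rUnitor

lemma proj_tensMap_tensorHom {M M' N N' : RMod A} (f : M ⟶ M') (g : N ⟶ N') {X Y : C} (k : X ⟶ Y) :
    proj M N ▷ X ≫ ((tensMap f g).hom ⊗ₘ k) = ((f.hom ⊗ₘ g.hom) ⊗ₘ k) ≫ proj M' N' ▷ Y := by
  rw [← tensorHom_id, tensorHom_comp_tensorHom, proj_tensMap, Category.id_comp,
    ← tensorHom_id, tensorHom_comp_tensorHom, Category.comp_id]

lemma tensorHom_proj_tensMap {M M' N N' : RMod A} (f : M ⟶ M') (g : N ⟶ N') {X Y : C} (k : X ⟶ Y) :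
    X ◁ proj M N ≫ (k ⊗ₘ (tensMap f g).hom) = (k ⊗ₘ (f.hom ⊗ₘ g.hom)) ≫ Y ◁ proj M' N' := by
  rw [← id_tensorHom, tensorHom_comp_tensorHom, proj_tensMap, Category.id_comp,
    ← id_tensorHom, tensorHom_comp_tensorHom, Category.comp_id]

noncomputable instance : MonoidalCategory (RMod A) :=
  MonoidalCategory.ofTensorHom
    (id_tensorHom_id := by
      intro M N
      change tensMap (𝟙 M) (𝟙 N) = 𝟙 (tens M N)
      apply tens_ext; simp)
    (tensorHom_comp_tensorHom := by
      intro M N P M' N' P' f f' g g'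
      change tensMap f f' ≫ tensMap g g' = tensMap (f ≫ g) (f' ≫ g')
      apply tens_ext; simp)
    (associator_naturality := by
      intro M N P M' N' P' f g k
      change tensMap (tensMap f g) k ≫ (assoc _ _ _).hom =
        (assoc _ _ _).hom ≫ tensMap f (tensMap g k)
      apply tens_ext₃
      simp only [comp_hom, proj_tensMap_assoc, reassoc_of% proj_assoc,
        reassoc_of% proj_tensMap_tensorHom, proj_assoc, proj_tensMap,
        reassoc_of% tensorHom_proj_tensMap]
      rw [associator_naturality_assoc])
    (leftUnitor_naturality := by
      intro M N f
      change tensMap (𝟙 (regular A)) f ≫ (lUnitor _).hom = (lUnitor _).hom ≫ f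
      apply tens_ext
      simp only [comp_hom, proj_tensMap_assoc, proj_lUnitor]
      rw [← Category.assoc (proj _ _), proj_lUnitor, hom_lact, id_hom, id_tensorHom])
    (rightUnitor_naturality := by
      intro M N f
      change tensMap f (𝟙 (regular A)) ≫ (rUnitor _).hom = (rUnitor _).hom ≫ f
      apply tens_ext
      simp only [comp_hom, proj_tensMap_assoc, proj_rUnitor]
      rw [← Category.assoc (proj _ _), proj_rUnitor, f.comm, id_hom, tensorHom_id])
    (pentagon := by
      intro W X Y Z
      change tensMap (assoc W X Y).hom (𝟙 Z) ≫ (assoc W (tens X Y) Z).hom ≫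
        tensMap (𝟙 W) (assoc X Y Z).hom = (assoc (tens W X) Y Z).hom ≫ (assoc W X (tens Y Z)).hom
      apply tens_ext₃
      rw [← cancel_epi ((proj W X ▷ Y.X) ▷ Z.X)]
      simp only [comp_hom, proj_tensMap_assoc, reassoc_of% proj_assoc, id_hom, tensorHom_id]
      simp only [← comp_whiskerRight_assoc, proj_assoc]
      simp only [comp_whiskerRight, Category.assoc, reassoc_of% proj_assoc, proj_tensMap,
        id_hom, id_tensorHom]
      simp only [associator_naturality_middle_assoc, ← MonoidalCategory.whiskerLeft_comp_assoc,
        proj_assoc, associator_naturality_left_assoc]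
      rw [← whisker_exchange_assoc, proj_assoc]
      simp)
    (triangle := by
      intro M N
      change (assoc M (regular A) N).hom ≫ tensMap (𝟙 M) (lUnitor N).hom =
        tensMap (rUnitor M).hom (𝟙 N)
      apply tens_ext₃
      simp only [comp_hom, reassoc_of% proj_assoc, proj_tensMap, id_hom, id_tensorHom,
        tensorHom_id, ← MonoidalCategory.whiskerLeft_comp_assoc, ← comp_whiskerRight_assoc,
        proj_lUnitor, proj_rUnitor]
      exact (proj_balanced M N).symm)

lemma isLocal_regular : (regular A).IsLocal := by
  have h : (β_ A A).hom ≫ μ[A] = μ[A] := IsCommMonObj.mul_comm A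
  change (β_ A A).hom ≫ (β_ A A).hom ≫ μ[A] = μ[A]
  rw [h, h]

lemma isLocal_tens {M N : RMod A} (hM : M.IsLocal) (hN : N.IsLocal) : (M.tens N).IsLocal := by
  have b := proj_balanced M N
  have e : proj M N ▷ A ≫ (β_ (tens M N).X A).hom ≫ (β_ A (tens M N).X).hom =
      (β_ (M.X ⊗ N.X) A).hom ≫ (β_ A (M.X ⊗ N.X)).hom ≫ proj M N ▷ A := by simp
  unfold IsLocal
  rw [← cancel_epi (proj M N ▷ A), reassoc_of% e, proj_act]
  calc
    _ = (β_ (M.X ⊗ N.X) A).hom ≫ (α_ A M.X N.X).inv ≫ (β_ A M.X).hom ▷ N.X ≫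
        (α_ M.X A N.X).hom ≫ M.X ◁ N.lact ≫ proj M N := by simp [lact]
    _ = (α_ M.X N.X A).hom ≫ M.X ◁ (β_ N.X A).hom ≫ (α_ M.X A N.X).inv ≫
        ((β_ M.X A).hom ≫ (β_ A M.X).hom ≫ M.act) ▷ N.X ≫ proj M N := by rw [← b]; simp
    _ = (α_ M.X N.X A).hom ≫ M.X ◁ ((β_ N.X A).hom ≫ (β_ A N.X).hom ≫ N.act) ≫ proj M N := by
      rw [hM, b]; simp [lact]
    _ = _ := by rw [hN]

lemma braid_balanced {M N : RMod A} (hM : M.IsLocal) :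
    M.act ▷ N.X ≫ (β_ M.X N.X).hom ≫ proj N M =
      (α_ M.X A N.X).hom ≫ M.X ◁ N.lact ≫ (β_ M.X N.X).hom ≫ proj N M := by
  have b := proj_balanced N M
  symm
  calc
    _ = (α_ M.X A N.X).hom ≫ (β_ M.X (A ⊗ N.X)).hom ≫ (β_ A N.X).hom ▷ M.X ≫
        N.act ▷ M.X ≫ proj N M := by
      rw [BraidedCategory.braiding_naturality_right_assoc]; simp [lact]
    _ = (β_ M.X A).hom ▷ N.X ≫ (β_ (A ⊗ M.X) N.X).hom ≫ N.X ◁ (β_ A M.X).hom ≫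
        N.X ◁ M.act ≫ proj N M := by rw [b]; simp [lact]
    _ = (β_ (M.X ⊗ A) N.X).hom ≫ N.X ◁ ((β_ M.X A).hom ≫ (β_ A M.X).hom ≫ M.act) ≫ proj N M := by
      rw [BraidedCategory.braiding_naturality_left_assoc]; simp
    _ = _ := by rw [hM, BraidedCategory.braiding_naturality_left_assoc]

lemma braidInv_balanced {M N : RMod A} (hM : M.IsLocal) :
    N.act ▷ M.X ≫ (β_ M.X N.X).inv ≫ proj M N =
      (α_ N.X A M.X).hom ≫ N.X ◁ M.lact ≫ (β_ M.X N.X).inv ≫ proj M N := by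
  have b := proj_balanced M N
  rw [← cancel_epi (β_ M.X (N.X ⊗ A)).hom]
  symm
  calc
    _ = (α_ M.X N.X A).inv ≫ (β_ M.X N.X).hom ▷ A ≫ (α_ N.X M.X A).hom ≫
        N.X ◁ ((β_ M.X A).hom ≫ (β_ A M.X).hom ≫ M.act) ≫ (β_ M.X N.X).inv ≫ proj M N := by
      simp [lact]
    _ = (α_ M.X N.X A).inv ≫ (β_ M.X N.X).hom ▷ A ≫ (α_ N.X M.X A).hom ≫
        (β_ (M.X ⊗ A) N.X).inv ≫ M.act ▷ N.X ≫ proj M N := by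
      rw [hM, BraidedCategory.braiding_inv_naturality_right_assoc]
    _ = M.X ◁ N.act ≫ proj M N := by rw [b]; simp [lact]
    _ = _ := by rw [← BraidedCategory.braiding_naturality_right_assoc]; simp

lemma braid_comm {M N : RMod A} (hM : M.IsLocal) :
    (α_ M.X N.X A).hom ≫ M.X ◁ N.act ≫ (β_ M.X N.X).hom ≫ proj N M =
      (β_ M.X N.X).hom ▷ A ≫ (α_ N.X M.X A).hom ≫ N.X ◁ M.act ≫ proj N M := by
  have b := proj_balanced N M
  calc
    _ = (α_ M.X N.X A).hom ≫ (β_ M.X (N.X ⊗ A)).hom ≫ N.act ▷ M.X ≫ proj N M := by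
      rw [BraidedCategory.braiding_naturality_right_assoc]
    _ = (β_ M.X N.X).hom ▷ A ≫ (α_ N.X M.X A).hom ≫
        N.X ◁ ((β_ M.X A).hom ≫ (β_ A M.X).hom ≫ M.act) ≫ proj N M := by rw [b]; simp [lact]
    _ = _ := by rw [hM]

/-- The braiding of `C` descends to relative tensor products of local modules. -/
noncomputable def braid (M N : RMod A) (hM : M.IsLocal) : tens M N ≅ tens N M :=
  isoMk { hom := desc ((β_ M.X N.X).hom ≫ proj N M) (braid_balanced hM)
          inv := desc ((β_ M.X N.X).inv ≫ proj M N) (braidInv_balanced hM)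
          hom_inv_id := by rw [← cancel_epi (proj _ _)]; simp
          inv_hom_id := by rw [← cancel_epi (proj _ _)]; simp } (by
    rw [← cancel_epi (proj M N ▷ A), ← Category.assoc, proj_act, ← comp_whiskerRight_assoc]
    simp only [Category.assoc, proj_desc, comp_whiskerRight, proj_act]
    exact braid_comm hM)

@[simp] lemma proj_braid (M N : RMod A) (hM : M.IsLocal) :
    proj M N ≫ (braid M N hM).hom.hom = (β_ M.X N.X).hom ≫ proj N M :=
  proj_desc _ (braid_balanced hM)

lemma proj_assoc_inv (M N P : RMod A) :
    M.X ◁ proj N P ≫ proj M (tens N P) ≫ (assoc M N P).inv.hom =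
      (α_ M.X N.X P.X).inv ≫ proj M N ▷ P.X ≫ proj (tens M N) P := by
  change M.X ◁ proj N P ≫ proj M (tens N P) ≫ assocInv M N P = _
  rw [proj_assocInv, proj_assocInvAux]

lemma tens_ext₃' {M N P Q : RMod A} {f g : tens M (tens N P) ⟶ Q}
    (h : M.X ◁ proj N P ≫ proj M (tens N P) ≫ f.hom =
      M.X ◁ proj N P ≫ proj M (tens N P) ≫ g.hom) : f = g :=
  tens_ext ((cancel_epi _).1 h)

lemma braid_naturality {M M' N N' : RMod A} (hM : M.IsLocal) (hM' : M'.IsLocal)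
    (f : M ⟶ M') (g : N ⟶ N') :
    tensMap f g ≫ (braid M' N' hM').hom = (braid M N hM).hom ≫ tensMap g f := by
  apply tens_ext
  simp only [comp_hom, proj_tensMap_assoc, proj_braid, reassoc_of% proj_braid, proj_tensMap]
  rw [BraidedCategory.braiding_naturality_assoc]

lemma hexagon₁ (X Y Z : RMod A) (hX : X.IsLocal) :
    (assoc X Y Z).hom ≫ (braid X (tens Y Z) hX).hom ≫ (assoc Y Z X).hom =
      tensMap (braid X Y hX).hom (𝟙 Z) ≫ (assoc Y X Z).hom ≫ tensMap (𝟙 Y) (braid X Z hX).hom := by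
  apply tens_ext₃
  simp only [comp_hom, reassoc_of% proj_assoc, reassoc_of% proj_braid, proj_tensMap_assoc,
    BraidedCategory.braiding_naturality_right_assoc, proj_assoc, id_hom, tensorHom_id,
    ← comp_whiskerRight_assoc, proj_braid]
  simp only [comp_whiskerRight, Category.assoc, reassoc_of% proj_assoc, proj_tensMap, id_hom,
    id_tensorHom, ← MonoidalCategory.whiskerLeft_comp_assoc, proj_braid]
  simp

lemma hexagon₂ (X Y Z : RMod A) (hX : X.IsLocal) (hY : Y.IsLocal) (hXY : (tens X Y).IsLocal) :
    (assoc X Y Z).inv ≫ (braid (tens X Y) Z hXY).hom ≫ (assoc Z X Y).inv =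
      tensMap (𝟙 X) (braid Y Z hY).hom ≫ (assoc X Z Y).inv ≫ tensMap (braid X Z hX).hom (𝟙 Y) := by
  apply tens_ext₃'
  simp only [comp_hom, reassoc_of% proj_assoc_inv, reassoc_of% proj_braid, proj_tensMap_assoc,
    BraidedCategory.braiding_naturality_left_assoc, proj_assoc_inv, id_hom, id_tensorHom,
    ← MonoidalCategory.whiskerLeft_comp_assoc, proj_braid]
  simp only [MonoidalCategory.whiskerLeft_comp, Category.assoc, reassoc_of% proj_assoc_inv,
    proj_tensMap, id_hom,
    tensorHom_id, ← comp_whiskerRight_assoc, proj_braid]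
  simp

/-- The separability idempotent `p_{M,N}` on `M ⊗ N` attached to a bimodule section `s` of the
multiplication: it applies `s ∘ i` in the middle and lets the two copies of `A` act on `M` and,
through the half-braiding, on `N`. -/
def sepIdem (s : A ⟶ A ⊗ A) (M N : RMod A) : M.X ⊗ N.X ⟶ M.X ⊗ N.X :=
  M.X ◁ ((λ_ N.X).inv ≫ (η[A] ≫ s) ▷ N.X ≫ (α_ A A N.X).hom ≫ A ◁ N.lact) ≫
    (α_ M.X A N.X).inv ≫ M.act ▷ N.X

lemma sepIdem_proj {s : A ⟶ A ⊗ A} (hs : s ≫ μ[A] = 𝟙 A) (M N : RMod A) :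
    sepIdem s M N ≫ proj M N = proj M N := by
  have b := proj_balanced M N
  have h : (λ_ N.X).inv ≫ (η[A] ≫ s) ▷ N.X ≫ (α_ A A N.X).hom ≫ A ◁ N.lact ≫ N.lact = 𝟙 _ := by
    rw [← mul_lact, ← comp_whiskerRight_assoc, Category.assoc, hs, Category.comp_id, one_lact]
    simp
  unfold sepIdem
  rw [Category.assoc, Category.assoc, b, Iso.inv_hom_id_assoc,
    ← MonoidalCategory.whiskerLeft_comp_assoc]
  simp only [Category.assoc] at h ⊢
  rw [h]
  simp

lemma sepIdem_balanced {s : A ⟶ A ⊗ A} (hl : A ◁ s ≫ (α_ A A A).inv ≫ μ[A] ▷ A = μ[A] ≫ s)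
    (hr : s ▷ A ≫ (α_ A A A).hom ≫ A ◁ μ[A] = μ[A] ≫ s) (M N : RMod A) :
    M.act ▷ N.X ≫ sepIdem s M N = (α_ M.X A N.X).hom ≫ M.X ◁ N.lact ≫ sepIdem s M N := by
  have hl' : (ρ_ A).inv ≫ A ◁ (η[A] ≫ s) ≫ (α_ A A A).inv ≫ μ[A] ▷ A = s := by
    rw [MonoidalCategory.whiskerLeft_comp_assoc, hl]; simp
  have hr' : (λ_ A).inv ≫ (η[A] ≫ s) ▷ A ≫ (α_ A A A).hom ≫ A ◁ μ[A] = s := by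
    rw [comp_whiskerRight_assoc, hr]; simp
  set X := (λ_ N.X).inv ≫ (η[A] ≫ s) ▷ N.X ≫ (α_ A A N.X).hom ≫ A ◁ N.lact with hX
  have k₁ : A ◁ X ≫ (α_ A A N.X).inv ≫ μ[A] ▷ N.X = s ▷ N.X ≫ (α_ A A N.X).hom ≫ A ◁ N.lact := by
    calc
      _ = ((ρ_ A).inv ≫ A ◁ (η[A] ≫ s) ≫ (α_ A A A).inv ≫ μ[A] ▷ A) ▷ N.X ≫
          (α_ A A N.X).hom ≫ A ◁ N.lact := by
        have e : (A ◁ A ◁ N.lact) ≫ (α_ A A N.X).inv ≫ μ[A] ▷ N.X =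
            (α_ A A _).inv ≫ μ[A] ▷ (A ⊗ N.X) ≫ A ◁ N.lact := by
          rw [← whisker_exchange]; simp
        simp only [hX, MonoidalCategory.whiskerLeft_comp, Category.assoc, e]
        simp
      _ = _ := by rw [hl']
  have k₂ : N.lact ≫ X = s ▷ N.X ≫ (α_ A A N.X).hom ≫ A ◁ N.lact := by
    calc
      _ = (λ_ _).inv ≫ (η[A] ≫ s) ▷ (A ⊗ N.X) ≫ (α_ A A _).hom ≫ A ◁ (A ◁ N.lact ≫ N.lact) := by
        have e : N.lact ≫ (λ_ N.X).inv ≫ (η[A] ≫ s) ▷ N.X =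
            (λ_ _).inv ≫ (η[A] ≫ s) ▷ (A ⊗ N.X) ≫ (A ⊗ A) ◁ N.lact := by
          rw [← whisker_exchange]; simp
        rw [hX, reassoc_of% e]
        simp
      _ = ((λ_ A).inv ≫ (η[A] ≫ s) ▷ A ≫ (α_ A A A).hom ≫ A ◁ μ[A]) ▷ N.X ≫
          (α_ A A N.X).hom ≫ A ◁ N.lact := by
        have m : A ◁ N.lact ≫ N.lact = (α_ A A N.X).inv ≫ μ[A] ▷ N.X ≫ N.lact := by
          rw [mul_lact]; simp
        rw [m, whiskerRight_tensor]
        simp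
      _ = _ := by rw [hr']
  have k₃ : sepIdem s M N = M.X ◁ X ≫ (α_ M.X A N.X).inv ≫ M.act ▷ N.X := rfl
  calc
    _ = (M.X ⊗ A) ◁ X ≫ (α_ (M.X ⊗ A) A N.X).inv ≫ (M.act ▷ A ≫ M.act) ▷ N.X := by
      rw [k₃, ← whisker_exchange_assoc]; simp
    _ = (α_ M.X A N.X).hom ≫ M.X ◁ (A ◁ X ≫ (α_ A A N.X).inv ≫ μ[A] ▷ N.X) ≫
        (α_ M.X A N.X).inv ≫ M.act ▷ N.X := by rw [act_act]; simp
    _ = _ := by rw [k₁, ← k₂, k₃]; simp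

/-- The relative tensor product is the image of the separability idempotent. -/
lemma sepIdem_split {s : A ⟶ A ⊗ A} (hs : s ≫ μ[A] = 𝟙 A)
    (hl : A ◁ s ≫ (α_ A A A).inv ≫ μ[A] ▷ A = μ[A] ≫ s)
    (hr : s ▷ A ≫ (α_ A A A).hom ≫ A ◁ μ[A] = μ[A] ≫ s) (M N : RMod A) :
    ∃ i : (tens M N).X ⟶ M.X ⊗ N.X, proj M N ≫ i = sepIdem s M N ∧ i ≫ proj M N = 𝟙 _ := by
  refine ⟨desc _ (sepIdem_balanced hl hr M N), proj_desc _ _, ?_⟩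
  rw [← cancel_epi (proj M N), proj_desc_assoc, sepIdem_proj hs, Category.comp_id]


end Tensor
end Braided
end RMod

section Local

variable [BraidedCategory C]

/-- Local right modules as a property of right modules. -/
def isLocal (A : C) [MonObj A] : ObjectProperty (RMod A) := RMod.IsLocal

/-- The category `C_A^loc` of local right modules. -/
abbrev LocMod (A : C) [MonObj A] := (isLocal A).FullSubcategory

variable [HasCoequalizers C] [∀ Z : C, PreservesColimitsOfShape WalkingParallelPair (tensorLeft Z)]

instance (A : C) [MonObj A] [IsCommMonObj A] : (isLocal A).IsMonoidal where
  prop_unit := RMod.isLocal_regular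
  prop_tensor _ _ hM hN := RMod.isLocal_tens hM hN

noncomputable instance (A : C) [MonObj A] [IsCommMonObj A] : BraidedCategory (LocMod A) where
  braiding M N := (isLocal A).isoMk (RMod.braid M.obj N.obj M.property)
  braiding_naturality_right M N P f := by
    apply ObjectProperty.hom_ext
    exact RMod.braid_naturality M.property M.property (𝟙 M.obj) f.hom
  braiding_naturality_left {M N} f P := by
    apply ObjectProperty.hom_ext
    exact RMod.braid_naturality M.property N.property f.hom (𝟙 P.obj)
  hexagon_forward X Y Z := by
    apply ObjectProperty.hom_ext
    exact RMod.hexagon₁ X.obj Y.obj Z.obj X.property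
  hexagon_reverse X Y Z := by
    apply ObjectProperty.hom_ext
    exact RMod.hexagon₂ X.obj Y.obj Z.obj X.property Y.property
      (RMod.isLocal_tens X.property Y.property)

end Local
end Modules

section CategoricalGroups

/-- Strong monoidal functors, bundled with their monoidal structure. -/
structure StrongMonoidalFunctor (𝒢 : Type*) [Category* 𝒢] [MonoidalCategory 𝒢]
    (ℋ : Type*) [Category* ℋ] [MonoidalCategory ℋ] where
  toFunctor : 𝒢 ⥤ ℋ
  monoidal : toFunctor.Monoidal

namespace StrongMonoidalFunctor

attribute [instance] monoidal

variable {𝒢 : Type*} [Category* 𝒢] [MonoidalCategory 𝒢] {ℋ : Type*} [Category* ℋ]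
  [MonoidalCategory ℋ] {𝒦 : Type*} [Category* 𝒦] [MonoidalCategory 𝒦]

/-- Composition of strong monoidal functors. -/
def comp (F : StrongMonoidalFunctor 𝒢 ℋ) (H : StrongMonoidalFunctor ℋ 𝒦) :
    StrongMonoidalFunctor 𝒢 𝒦 where
  toFunctor := F.toFunctor ⋙ H.toFunctor
  monoidal := inferInstance

/-- The unit constraint `1 ⟶ F(1)`. -/
abbrev unit (F : StrongMonoidalFunctor 𝒢 ℋ) : 𝟙_ ℋ ⟶ F.toFunctor.obj (𝟙_ 𝒢) :=
  Functor.LaxMonoidal.ε F.toFunctor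

/-- The tensorator `F(X) ⊗ F(Y) ⟶ F(X ⊗ Y)`. -/
abbrev tensorator (F : StrongMonoidalFunctor 𝒢 ℋ) (X Y : 𝒢) :
    F.toFunctor.obj X ⊗ F.toFunctor.obj Y ⟶ F.toFunctor.obj (X ⊗ Y) :=
  Functor.LaxMonoidal.μ F.toFunctor X Y

end StrongMonoidalFunctor

/-- Linear braided autoequivalences of a linear braided monoidal category. -/
structure AutBr (D : Type u) [Category.{v} D] [Preadditive D] [Linear ℂ D] [MonoidalCategory D]
    [BraidedCategory D] where
  functor : D ⥤ D
  braided : functor.Braided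
  isEquivalence : functor.IsEquivalence
  additive : functor.Additive
  linear : functor.Linear ℂ

namespace AutBr

attribute [instance] braided isEquivalence additive linear

variable {D : Type u} [Category.{v} D] [Preadditive D] [Linear ℂ D] [MonoidalCategory D]
  [BraidedCategory D]

/-- Monoidal natural isomorphisms. -/
@[ext]
structure Hom (a b : AutBr D) where
  iso : a.functor ≅ b.functor
  isMonoidal : NatTrans.IsMonoidal iso.hom

attribute [instance] Hom.isMonoidal

instance : Category (AutBr D) where
  Hom a b := Hom a b
  id a := ⟨Iso.refl _, inferInstanceAs (NatTrans.IsMonoidal (𝟙 a.functor))⟩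
  comp f g := ⟨f.iso ≪≫ g.iso, inferInstanceAs (NatTrans.IsMonoidal (f.iso.hom ≫ g.iso.hom))⟩
  id_comp _ := Hom.ext (Iso.ext (Category.id_comp _))
  comp_id _ := Hom.ext (Iso.ext (Category.comp_id _))
  assoc _ _ _ := Hom.ext (Iso.ext (Category.assoc _ _ _))

/-- The component at an object of a monoidal natural isomorphism. -/
abbrev app {a b : AutBr D} (f : a ⟶ b) (X : D) : a.functor.obj X ⟶ b.functor.obj X :=
  (Hom.iso f).hom.app X

@[ext]
lemma hom_ext {a b : AutBr D} {f g : a ⟶ b} (h : ∀ X, app f X = app g X) : f = g :=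
  Hom.ext (Iso.ext (NatTrans.ext (funext h)))

@[simp] lemma id_app (a : AutBr D) (X : D) : app (𝟙 a) X = 𝟙 _ := rfl
@[simp] lemma comp_app {a b c : AutBr D} (f : a ⟶ b) (g : b ⟶ c) (X : D) :
    app (f ≫ g) X = app f X ≫ app g X := rfl

/-- Every 2-morphism is invertible. -/
instance : Groupoid (AutBr D) where
  inv f := ⟨(Hom.iso f).symm, inferInstanceAs (NatTrans.IsMonoidal (Hom.iso f).inv)⟩
  inv_comp f := hom_ext fun X => (Hom.iso f).inv_hom_id_app X
  comp_inv f := hom_ext fun X => (Hom.iso f).hom_inv_id_app X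

/-- The composite `a ∘ b`. -/
abbrev comp (a b : AutBr D) : AutBr D where
  functor := b.functor ⋙ a.functor
  braided := inferInstance
  isEquivalence := inferInstance
  additive := inferInstance
  linear := inferInstance

variable (D) in
/-- The identity autoequivalence. -/
abbrev one : AutBr D where
  functor := 𝟭 D
  braided := inferInstance
  isEquivalence := inferInstance
  additive := inferInstance
  linear := inferInstance

/-- An isomorphism in `AutBr D` from a monoidal natural isomorphism. -/
def isoMk {a b : AutBr D} (e : a.functor ≅ b.functor) (h : NatTrans.IsMonoidal e.hom) : a ≅ b where
  hom := ⟨e, h⟩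
  inv := ⟨e.symm, inferInstanceAs (NatTrans.IsMonoidal e.inv)⟩
  hom_inv_id := hom_ext fun X => e.hom_inv_id_app X
  inv_hom_id := hom_ext fun X => e.inv_hom_id_app X

instance : MonoidalCategoryStruct (AutBr D) where
  tensorObj a b := comp a b
  tensorUnit := one D
  whiskerLeft a _ _ f := ⟨Functor.isoWhiskerRight (Hom.iso f) a.functor,
    inferInstanceAs (NatTrans.IsMonoidal (Functor.whiskerRight (Hom.iso f).hom a.functor))⟩
  whiskerRight f a := ⟨Functor.isoWhiskerLeft a.functor (Hom.iso f),
    inferInstanceAs (NatTrans.IsMonoidal (Functor.whiskerLeft a.functor (Hom.iso f).hom))⟩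
  associator a b c := (isoMk (a := comp a (comp b c)) (b := comp (comp a b) c)
    (Functor.associator c.functor b.functor a.functor) inferInstance).symm
  leftUnitor a := isoMk (a := comp (one D) a) a.functor.rightUnitor inferInstance
  rightUnitor a := isoMk (a := comp a (one D)) a.functor.leftUnitor inferInstance

@[simp] lemma whiskerLeft_app (a : AutBr D) {b c : AutBr D} (f : b ⟶ c) (X : D) :
    app (a ◁ f) X = a.functor.map (app f X) := rfl
@[simp] lemma whiskerRight_app {b c : AutBr D} (f : b ⟶ c) (a : AutBr D) (X : D) :
    app (f ▷ a) X = app f (a.functor.obj X) := rfl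
@[simp] lemma associator_hom_app (a b c : AutBr D) (X : D) :
    app (α_ a b c).hom X = 𝟙 (a.functor.obj (b.functor.obj (c.functor.obj X))) := rfl
@[simp] lemma leftUnitor_hom_app (a : AutBr D) (X : D) :
    app (λ_ a).hom X = 𝟙 (a.functor.obj X) := rfl
@[simp] lemma rightUnitor_hom_app (a : AutBr D) (X : D) :
    app (ρ_ a).hom X = 𝟙 (a.functor.obj X) := rfl

@[simp] lemma tensorHom_app {a b c d : AutBr D} (f : a ⟶ b) (g : c ⟶ d) (X : D) :
    app (f ⊗ₘ g) X = app f (c.functor.obj X) ≫ b.functor.map (app g X) := rfl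

lemma app_naturality {a b : AutBr D} (f : a ⟶ b) {X Y : D} (k : X ⟶ Y) :
    a.functor.map k ≫ app f Y = app f X ≫ b.functor.map k := (Hom.iso f).hom.naturality k

lemma functor_tensor (a b : AutBr D) : (a ⊗ b).functor = b.functor ⋙ a.functor := rfl

lemma functor_unit : (𝟙_ (AutBr D)).functor = 𝟭 D := rfl

/-- The categorical group of braided autoequivalences, with tensor product the composition. -/
instance : MonoidalCategory (AutBr D) where
  tensorHom_def _ _ := rfl
  id_tensorHom_id a b := by
    ext X
    change 𝟙 _ ≫ a.functor.map (𝟙 _) = 𝟙 _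
    simp
  tensorHom_comp_tensorHom {a₁ b₁ c₁ a₂ b₂ c₂} f₁ f₂ g₁ g₂ := by
    ext X
    change (app f₁ _ ≫ b₁.functor.map (app f₂ X)) ≫ app g₁ _ ≫ c₁.functor.map (app g₂ X) =
      (app f₁ _ ≫ app g₁ _) ≫ c₁.functor.map (app f₂ X ≫ app g₂ X)
    simp
  whiskerLeft_id a b := by
    ext X
    exact a.functor.map_id _
  id_whiskerRight a b := rfl
  associator_naturality {a₁ a₂ a₃ b₁ b₂ b₃} f g h := by
    ext X
    change ((app f _ ≫ b₁.functor.map (app g _)) ≫ b₁.functor.map (b₂.functor.map (app h X))) ≫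
      𝟙 _ = 𝟙 _ ≫ app f _ ≫ b₁.functor.map (app g _ ≫ b₂.functor.map (app h X))
    simp
  leftUnitor_naturality f := by
    ext X
    change app f X ≫ 𝟙 _ = 𝟙 _ ≫ app f X
    simp
  rightUnitor_naturality {a b} f := by
    ext X
    change app f X ≫ 𝟙 _ = 𝟙 _ ≫ app f X
    simp
  pentagon a b c d := by
    ext X
    change 𝟙 _ ≫ 𝟙 _ ≫ a.functor.map (𝟙 _) = 𝟙 _ ≫ 𝟙 _
    simp
  triangle a b := by
    ext X
    change 𝟙 _ ≫ a.functor.map (𝟙 _) = 𝟙 _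
    simp

end AutBr

section Pairs

variable {C : Type u} [Category.{v} C] [Preadditive C] [Linear ℂ C] [MonoidalCategory C]
  [BraidedCategory C]

open scoped Obj

/-- An algebra isomorphism `a(A) ≅ A`, where `a(A)` has the multiplication `a(m) ∘ ψ_{A,A}` and
the unit `a(i)` (precomposed with the unit constraint of `a`). -/
structure AlgIso (a : AutBr C) (A : C) [MonObj A] where
  iso : a.functor.obj A ≅ A
  isMonHom : IsMonHom iso.hom

/-- The full categorical subgroup of autoequivalences `a` such that `a(A) ≅ A` as algebras. -/
def Stab (A : C) [MonObj A] : ObjectProperty (AutBr C) := fun a => Nonempty (AlgIso a A)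

/-- Pairs of a braided autoequivalence `a` and an algebra isomorphism `a(A) ≅ A`. -/
structure AutPair (A : C) [MonObj A] where
  aut : AutBr C
  lam : AlgIso aut A

namespace AutPair

variable {A : C} [MonObj A]

/-- Monoidal natural isomorphisms compatible with the chosen algebra isomorphisms. -/
@[ext]
structure Hom (a b : AutPair A) where
  hom : a.aut ⟶ b.aut
  comm : AutBr.app hom A ≫ b.lam.iso.hom = a.lam.iso.hom

instance : Category (AutPair A) where
  Hom a b := Hom a b
  id a := ⟨𝟙 a.aut, Category.id_comp _⟩
  comp f g := ⟨f.hom ≫ g.hom, by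
    rw [AutBr.comp_app, Category.assoc, g.comm, f.comm]⟩
  id_comp _ := Hom.ext (Category.id_comp _)
  comp_id _ := Hom.ext (Category.comp_id _)
  assoc _ _ _ := Hom.ext (Category.assoc _ _ _)

@[ext]
lemma hom_ext {a b : AutPair A} {f g : a ⟶ b} (h : f.hom = g.hom) : f = g := Hom.ext h

/-- An isomorphism of pairs from a compatible isomorphism of autoequivalences. -/
def isoMk {a b : AutPair A} (e : a.aut ≅ b.aut)
    (h : AutBr.app e.hom A ≫ b.lam.iso.hom = a.lam.iso.hom) : a ≅ b where
  hom := ⟨e.hom, h⟩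
  inv := ⟨e.inv, by
    rw [← h, ← Category.assoc, ← AutBr.comp_app, e.inv_hom_id, AutBr.id_app, Category.id_comp]⟩
  hom_inv_id := Hom.ext e.hom_inv_id
  inv_hom_id := Hom.ext e.inv_hom_id

lemma isMonHom_one : @IsMonHom C _ _ ((𝟙_ (AutBr C)).functor.obj A) A
    ((𝟭 C).monObjObj A) _ (𝟙 A) where
  one_hom := by
    change (𝟙 _ ≫ η[A]) ≫ 𝟙 A = η[A]
    simp
  mul_hom := by
    change (𝟙 _ ≫ μ[A]) ≫ 𝟙 A = (𝟙 A ⊗ₘ 𝟙 A) ≫ μ[A]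
    simp

lemma isMonHom_comp (a b : AutPair A) :
    @IsMonHom C _ _ ((a.aut ⊗ b.aut).functor.obj A) A
      ((b.aut.functor ⋙ a.aut.functor).monObjObj A) _
      (a.aut.functor.map b.lam.iso.hom ≫ a.lam.iso.hom) := by
  have hb := b.lam.isMonHom
  have ha := a.lam.isMonHom
  have hb1 : (Functor.LaxMonoidal.ε b.aut.functor ≫ b.aut.functor.map η[A]) ≫ b.lam.iso.hom =
    η[A] := hb.one_hom
  have ha1 : (Functor.LaxMonoidal.ε a.aut.functor ≫ a.aut.functor.map η[A]) ≫ a.lam.iso.hom =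
    η[A] := ha.one_hom
  have hb2 : (Functor.LaxMonoidal.μ b.aut.functor A A ≫ b.aut.functor.map μ[A]) ≫ b.lam.iso.hom =
    (b.lam.iso.hom ⊗ₘ b.lam.iso.hom) ≫ μ[A] := hb.mul_hom
  have ha2 : (Functor.LaxMonoidal.μ a.aut.functor A A ≫ a.aut.functor.map μ[A]) ≫ a.lam.iso.hom =
    (a.lam.iso.hom ⊗ₘ a.lam.iso.hom) ≫ μ[A] := ha.mul_hom
  refine @IsMonHom.mk _ _ _ _ _ _ _ _ ?_ ?_
  · change (((Functor.LaxMonoidal.ε a.aut.functor ≫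
      a.aut.functor.map (Functor.LaxMonoidal.ε b.aut.functor)) ≫
      a.aut.functor.map (b.aut.functor.map η[A])) ≫ a.aut.functor.map b.lam.iso.hom ≫
        a.lam.iso.hom) = η[A]
    simp only [Category.assoc, ← Functor.map_comp_assoc] at *
    rw [hb1, ha1]
  · change (((Functor.LaxMonoidal.μ a.aut.functor _ _ ≫
      a.aut.functor.map (Functor.LaxMonoidal.μ b.aut.functor A A)) ≫
      a.aut.functor.map (b.aut.functor.map μ[A])) ≫ a.aut.functor.map b.lam.iso.hom ≫
        a.lam.iso.hom) = ((a.aut.functor.map b.lam.iso.hom ≫ a.lam.iso.hom) ⊗ₘ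
          (a.aut.functor.map b.lam.iso.hom ≫ a.lam.iso.hom)) ≫ μ[A]
    simp only [Category.assoc, ← Functor.map_comp_assoc] at *
    rw [hb2, ← tensorHom_comp_tensorHom, Category.assoc, ← ha2]
    simp

variable (A) in
/-- The identity functor with the identity of `A`. -/
abbrev one : AutPair A where
  aut := 𝟙_ (AutBr C)
  lam := ⟨Iso.refl A, isMonHom_one⟩

/-- The composite `(a, λ) ∘ (b, κ) = (a ∘ b, λ ∘ a(κ))`. -/
abbrev comp (a b : AutPair A) : AutPair A where
  aut := a.aut ⊗ b.aut
  lam := ⟨a.aut.functor.mapIso b.lam.iso ≪≫ a.lam.iso, isMonHom_comp a b⟩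

instance : MonoidalCategoryStruct (AutPair A) where
  tensorObj a b := comp a b
  tensorUnit := one A
  whiskerLeft a b c f := ⟨a.aut ◁ f.hom, by
    change a.aut.functor.map _ ≫ a.aut.functor.map _ ≫ _ = a.aut.functor.map _ ≫ _
    rw [← Functor.map_comp_assoc, f.comm]⟩
  whiskerRight {a b} f c := ⟨f.hom ▷ c.aut, by
    change AutBr.app f.hom _ ≫ b.aut.functor.map _ ≫ _ = a.aut.functor.map _ ≫ _
    rw [← f.comm, reassoc_of% (AutBr.app_naturality f.hom c.lam.iso.hom)]⟩
  associator a b c := isoMk (α_ a.aut b.aut c.aut) (by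
    change 𝟙 _ ≫ a.aut.functor.map (b.aut.functor.map _ ≫ _) ≫ _ =
      a.aut.functor.map (b.aut.functor.map _) ≫ a.aut.functor.map _ ≫ _
    simp)
  leftUnitor a := isoMk (λ_ a.aut) (by
    change 𝟙 _ ≫ a.lam.iso.hom = a.lam.iso.hom ≫ 𝟙 _
    simp)
  rightUnitor a := isoMk (ρ_ a.aut) (by
    change 𝟙 _ ≫ _ = a.aut.functor.map (𝟙 _) ≫ _
    simp)

/-- The categorical group of pairs. -/
instance : MonoidalCategory (AutPair A) where
  tensorHom_def _ _ := rfl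
  id_tensorHom_id a b := Hom.ext (id_tensorHom_id a.aut b.aut)
  tensorHom_comp_tensorHom f g h k := Hom.ext (tensorHom_comp_tensorHom f.hom g.hom h.hom k.hom)
  whiskerLeft_id a b := Hom.ext (MonoidalCategory.whiskerLeft_id a.aut b.aut)
  id_whiskerRight a b := Hom.ext (MonoidalCategory.id_whiskerRight a.aut b.aut)
  associator_naturality f g h := Hom.ext (associator_naturality f.hom g.hom h.hom)
  leftUnitor_naturality f := Hom.ext (leftUnitor_naturality f.hom)
  rightUnitor_naturality f := Hom.ext (rightUnitor_naturality f.hom)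
  pentagon a b c d := Hom.ext (pentagon a.aut b.aut c.aut d.aut)
  triangle a b := Hom.ext (triangle a.aut b.aut)

variable (A) in
/-- The forgetful functor `(a, λ) ↦ a`. -/
def forgetFunctor : AutPair A ⥤ AutBr C where
  obj a := a.aut
  map f := f.hom

instance : (forgetFunctor A).Monoidal :=
  Functor.CoreMonoidal.toMonoidal
    { εIso := Iso.refl (𝟙_ (AutBr C))
      μIso := fun a b => Iso.refl (a.aut ⊗ b.aut)
      μIso_hom_natural_left := fun f c => by
        change f.hom ▷ c.aut ≫ 𝟙 _ = 𝟙 _ ≫ f.hom ▷ c.aut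
        simp
      μIso_hom_natural_right := fun c f => by
        change c.aut ◁ f.hom ≫ 𝟙 _ = 𝟙 _ ≫ c.aut ◁ f.hom
        simp
      associativity := fun a b c => by
        change 𝟙 (a.aut ⊗ b.aut) ▷ c.aut ≫ 𝟙 _ ≫ (α_ a.aut b.aut c.aut).hom =
          (α_ a.aut b.aut c.aut).hom ≫ a.aut ◁ 𝟙 (b.aut ⊗ c.aut) ≫ 𝟙 _
        simp
      left_unitality := fun a => by
        change (λ_ a.aut).hom = 𝟙 (𝟙_ (AutBr C)) ▷ a.aut ≫ 𝟙 _ ≫ (λ_ a.aut).hom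
        simp
      right_unitality := fun a => by
        change (ρ_ a.aut).hom = a.aut ◁ 𝟙 (𝟙_ (AutBr C)) ≫ 𝟙 _ ≫ (ρ_ a.aut).hom
        simp }

variable (A) in
/-- The forgetful functor, as a strong (in fact strict) monoidal functor. -/
def forget : StrongMonoidalFunctor (AutPair A) (AutBr C) := ⟨forgetFunctor A, inferInstance⟩

end AutPair

/-- A categorical action of `G` by braided autoequivalences: a strong monoidal functor from `G`,
seen as a discrete monoidal category. -/
abbrev CatAction (G : Type w) [Group G] (C : Type u) [Category.{v} C] [Preadditive C] [Linear ℂ C]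
    [MonoidalCategory C] [BraidedCategory C] :=
  StrongMonoidalFunctor (Discrete G) (AutBr C)

namespace CatAction

variable {G : Type w} [Group G]

/-- The autoequivalence by which `g` acts. -/
abbrev aut (ρ : CatAction G C) (g : G) : AutBr C := ρ.toFunctor.obj (Discrete.mk g)

/-- The tensorator `μ_{g,h} : g(h(X)) ⟶ (gh)(X)`. -/
abbrev mu (ρ : CatAction G C) (g h : G) (X : C) :
    (ρ.aut g).functor.obj ((ρ.aut h).functor.obj X) ⟶ (ρ.aut (g * h)).functor.obj X :=
  AutBr.app (ρ.tensorator (Discrete.mk g) (Discrete.mk h)) X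

/-- The unit constraint `X ⟶ e(X)`. -/
abbrev eps (ρ : CatAction G C) (X : C) : X ⟶ (ρ.aut 1).functor.obj X :=
  AutBr.app ρ.unit X

/-- Lifts of a categorical action along the forgetful functor `(a, λ) ↦ a`. -/
structure Lift (ρ : CatAction G C) (A : C) [MonObj A] where
  lift : StrongMonoidalFunctor (Discrete G) (AutPair A)
  comp_forget : lift.comp (AutPair.forget A) = ρ

/-- `G`-equivariant algebra structures on `A`: algebra isomorphisms `λ^g : g(A) ⟶ A` such that
`λ^g ∘ g(λ^h) = λ^{gh} ∘ μ_{g,h}`. -/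
structure EquivariantAlgebra (ρ : CatAction G C) (A : C) [MonObj A] where
  lam : ∀ g : G, AlgIso (ρ.aut g) A
  equivariant : ∀ g h : G, (ρ.aut g).functor.map (lam h).iso.hom ≫ (lam g).iso.hom =
    ρ.mu g h A ≫ (lam (g * h)).iso.hom

end CatAction

/-- Twisting right modules by a pair `(a, λ)`: the module `(M, r)` is sent to `a(M)` with the action
`a(r) ∘ ψ_{M,A} ∘ (id ⊗ λ⁻¹)`. -/
def twist {A : C} [MonObj A] (p : AutPair A) : RMod A ⥤ RMod A where
  obj M :=
    { X := p.aut.functor.obj M.X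
      act := p.aut.functor.obj M.X ◁ p.lam.iso.inv ≫ Functor.LaxMonoidal.μ p.aut.functor M.X A ≫
        p.aut.functor.map M.act
      act_one := by
        have h := p.lam.isMonHom.one_hom
        have h' : η[A] ≫ p.lam.iso.inv = Functor.LaxMonoidal.ε p.aut.functor ≫
          p.aut.functor.map η[A] := by rw [Iso.comp_inv_eq]; exact h.symm
        rw [← MonoidalCategory.whiskerLeft_comp_assoc, h']
        simp [← Functor.map_comp, M.act_one]
      act_mul := by
        have h := p.lam.isMonHom.mul_hom
        have h' : μ[A] ≫ p.lam.iso.inv = (p.lam.iso.inv ⊗ₘ p.lam.iso.inv) ≫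
            Functor.LaxMonoidal.μ p.aut.functor A A ≫ p.aut.functor.map μ[A] := by
          rw [Iso.comp_inv_eq]
          have h2 : (Functor.LaxMonoidal.μ p.aut.functor A A ≫ p.aut.functor.map μ[A]) ≫
            p.lam.iso.hom = (p.lam.iso.hom ⊗ₘ p.lam.iso.hom) ≫ μ[A] := h
          rw [Category.assoc, h2, tensorHom_comp_tensorHom_assoc]
          simp
        rw [← MonoidalCategory.whiskerLeft_comp_assoc, h']
        simp only [MonoidalCategory.whiskerLeft_comp, Category.assoc,
          Functor.LaxMonoidal.μ_natural_right_assoc, ← Functor.map_comp, M.act_mul]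
        simp only [Functor.map_comp, Functor.LaxMonoidal.associativity_inv_assoc,
          comp_whiskerRight, Category.assoc, ← Functor.LaxMonoidal.μ_natural_left_assoc]
        rw [← whisker_exchange_assoc, ← whisker_exchange_assoc, MonoidalCategory.tensorHom_def]
        simp }
  map f :=
    { hom := p.aut.functor.map f.hom
      comm := by
        simp only [Category.assoc, ← Functor.map_comp, f.comm]
        rw [← whisker_exchange_assoc, Functor.LaxMonoidal.μ_natural_left_assoc, Functor.map_comp] }
  map_id M := by ext; simp
  map_comp f g := by ext; simp

end Pairs

end CategoricalGroups

section Fusion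

attribute [local instance] Abelian.hasFiniteBiproducts

variable (C : Type u) [Category.{v} C] [MonoidalCategory C]

/-- In a rigid category the tensor product preserves coequalizers. -/
instance preservesCoequalizers_tensorLeft [RigidCategory C] (Z : C) :
    PreservesColimitsOfShape WalkingParallelPair (tensorLeft Z) :=
  (tensorLeftAdjunction (ᘁZ) Z).leftAdjoint_preservesColimits.preservesColimitsOfShape

/-- A rigid linear abelian monoidal category is a fusion category if it is semisimple with
finite-dimensional morphism spaces, finitely many simple objects up to isomorphism, and a simple
tensor unit. -/
structure IsFusion [Abelian C] [Linear ℂ C] [RigidCategory C] : Prop where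
  finite_hom : ∀ X Y : C, Module.Finite ℂ (X ⟶ Y)
  semisimple : ∀ X : C, ∃ (n : ℕ) (S : Fin n → C), (∀ i, Simple (S i)) ∧ Nonempty (X ≅ ⨁ S)
  finite_simple : ∃ (n : ℕ) (S : Fin n → C), ∀ X : C, Simple X → ∃ i, Nonempty (X ≅ S i)
  simple_unit : Simple (𝟙_ C)

/-- The braiding is non-degenerate: every object that is transparent (has trivial double braiding
with all objects) is a direct sum of copies of the tensor unit. -/
def IsNondegenerate [Abelian C] [BraidedCategory C] : Prop :=
  ∀ X : C, (∀ Y : C, (β_ X Y).hom ≫ (β_ Y X).hom = 𝟙 (X ⊗ Y)) →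
    ∃ n : ℕ, Nonempty (X ≅ ⨁ fun _ : Fin n => 𝟙_ C)

variable {C}

/-- An algebra is separable if its multiplication has a section which is a map of bimodules. -/
def IsSeparableAlgebra (A : C) [MonObj A] : Prop :=
  ∃ s : A ⟶ A ⊗ A, s ≫ μ[A] = 𝟙 A ∧
    A ◁ s ≫ (α_ A A A).inv ≫ μ[A] ▷ A = μ[A] ≫ s ∧
    s ▷ A ≫ (α_ A A A).hom ≫ A ◁ μ[A] = μ[A] ≫ s

/-- An algebra is connected if `Hom(1, A)` is one-dimensional. -/
def IsConnectedAlgebra [Preadditive C] [Linear ℂ C] (A : C) : Prop :=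
  Module.finrank ℂ (𝟙_ C ⟶ A) = 1

end Fusion

section Induced

variable {C : Type u} [Category.{v} C] [Preadditive C] [Linear ℂ C] [MonoidalCategory C]
  [MonoidalPreadditive C] [MonoidalLinear ℂ C] [BraidedCategory C] [HasCoequalizers C]
  [∀ Z : C, PreservesColimitsOfShape WalkingParallelPair (tensorLeft Z)]
  {A : C} [MonObj A] [IsCommMonObj A]

/-- A braided autoequivalence `b` of `C_A^loc` is given by twisting with the pair `p = (a, λ)`: its
underlying functor is identified with the twisting functor, its tensorator is induced by the
tensorator of `a` through the projections `M ⊗ N ⟶ M ⊗_A N`, and its unit constraint is `λ⁻¹`. -/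
structure TwistIso (p : AutPair A) (b : AutBr (LocMod A)) where
  iso : b.functor ⋙ (isLocal A).ι ≅ (isLocal A).ι ⋙ twist p
  tensor : ∀ M N : LocMod A,
    RMod.proj (b.functor.obj M).obj (b.functor.obj N).obj ≫
        (Functor.LaxMonoidal.μ b.functor M N).hom.hom ≫ (iso.hom.app (M ⊗ N)).hom =
      ((iso.hom.app M).hom ⊗ₘ (iso.hom.app N).hom) ≫
        Functor.LaxMonoidal.μ p.aut.functor M.obj.X N.obj.X ≫
          p.aut.functor.map (RMod.proj M.obj N.obj)
  unit : (Functor.LaxMonoidal.ε b.functor).hom.hom ≫ (iso.hom.app (𝟙_ (LocMod A))).hom =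
    p.lam.iso.inv

/-- The underlying isomorphism in `C` from `b(M)` to `a(M)`. -/
abbrev TwistIso.app {p : AutPair A} {b : AutBr (LocMod A)} (t : TwistIso p b) (M : LocMod A) :
    (b.functor.obj M).obj.X ⟶ p.aut.functor.obj M.obj.X :=
  (t.iso.hom.app M).hom

/-- A strong monoidal functor from pairs to braided autoequivalences of `C_A^loc` is the canonical
one: it sends a pair to the twist by this pair, a morphism `f` of pairs to the natural isomorphism
with components `f_M`, and its own monoidal constraints are the identities of
`a(b(M)) = (a ∘ b)(M)` and of `M`. -/
structure TwistFunctorData (F : StrongMonoidalFunctor (AutPair A) (AutBr (LocMod A))) where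
  tw : ∀ p : AutPair A, TwistIso p (F.toFunctor.obj p)
  map : ∀ {p q : AutPair A} (f : p ⟶ q) (M : LocMod A),
    (AutBr.app (F.toFunctor.map f) M).hom.hom ≫ (tw q).app M =
      (tw p).app M ≫ AutBr.app f.hom M.obj.X
  tensor : ∀ (p q : AutPair A) (M : LocMod A),
    (AutBr.app (F.tensorator p q) M).hom.hom ≫ (tw (p ⊗ q)).app M =
      (tw p).app ((F.toFunctor.obj q).functor.obj M) ≫ p.aut.functor.map ((tw q).app M)
  unit : ∀ M : LocMod A,
    (AutBr.app F.unit M).hom.hom ≫ (tw (𝟙_ (AutPair A))).app M = 𝟙 M.obj.X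

/-- A categorical action on `C_A^loc` is the one induced by the action `ρ` on `C` and the
equivariant algebra structure `l`: the element `g` acts by twisting with `(g, λ^g)`, and the
monoidal constraints are those of `ρ`. -/
structure InducedActionData {G : Type w} [Group G] (ρ : CatAction G C) (l : ρ.EquivariantAlgebra A)
    (σ : CatAction G (LocMod A)) where
  tw : ∀ g : G, TwistIso ⟨ρ.aut g, l.lam g⟩ (σ.aut g)
  tensor : ∀ (g h : G) (M : LocMod A),
    (σ.mu g h M).hom.hom ≫ (tw (g * h)).app M =
      (tw g).app ((σ.aut h).functor.obj M) ≫ (ρ.aut g).functor.map ((tw h).app M) ≫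
        ρ.mu g h M.obj.X
  unit : ∀ M : LocMod A, (σ.eps M).hom.hom ≫ (tw 1).app M = ρ.eps M.obj.X

end Induced

end Condensation

open Condensation

/-! A braided autoequivalence `a` respects everything built from tensor products, the braiding and
coequalizers. A pair `(a, λ)` moreover identifies `a(A)` with `A` as an algebra, so `a` acts on
`A`-modules once the action is pulled back along `λ⁻¹`. Because `a` is braided, the left action
coming from the half-braiding is twisted by the same formula as the right one (`twistObj_lact`), and
the double braiding inside the action is carried along, so locality is preserved and, `a` being
faithful, reflected (`isLocal_twistObj_iff`).

The product `M ⊗_A N` is the coequalizer of these two actions and an equivalence preserves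
coequalizers. Hence the tensorator `ψ` of `a` descends to an isomorphism `a(M) ⊗_A a(N) ≅ a(M ⊗_A
N)` (`twistTensorIso`). Every coherence law is an equation between maps out of relative tensor
products; composing with the epimorphic projections turns it into the corresponding law for `ψ`.
Twisting is an equivalence because any action on an object isomorphic to `a(X)` comes from an action
on `X` (`untwist`); reflection of locality then gives the equivalence on local modules.

Functoriality in the pair rests on two observations. The condition on a morphism `η` of pairs is
what makes the components `η_M` module maps. The composition law for pairs makes an iterated twist
and the twist by the composite have the same action on the same object (`comp_twistObj_act`), so
identities serve as the monoidal constraints.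

A pair adds to an autoequivalence only the datum `λ`, and being a morphism of pairs is a condition
on a natural isomorphism. A lift of an action `ρ` is therefore a family `λ^g` for which the
constraints of `ρ` are morphisms of pairs. For the tensorator this condition is equivariance; for
the unit constraint it then holds automatically (`eps_lam`). Composing a lift with the twisting
functor yields the induced action. -/

namespace Condensation

open Functor.LaxMonoidal Functor.OplaxMonoidal

/-! ### Twisting modules: locality, and the equivalence on local modules. -/

section Twist

variable {C : Type u} [Category.{v} C] [Preadditive C] [Linear ℂ C] [MonoidalCategory C]
  [BraidedCategory C] {A : C} [MonObj A]

/-- The twist of a module, with its underlying object and action in reducible form. -/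
abbrev twistObj (p : AutPair A) (M : RMod A) : RMod A where
  X := p.aut.functor.obj M.X
  act := p.aut.functor.obj M.X ◁ p.lam.iso.inv ≫ Functor.LaxMonoidal.μ p.aut.functor M.X A ≫
    p.aut.functor.map M.act
  act_one := ((twist p).obj M).act_one
  act_mul := ((twist p).obj M).act_mul

/-- The twist of a module map, between modules in reducible form. -/
abbrev twistMap (p : AutPair A) {M N : RMod A} (f : M ⟶ N) : twistObj p M ⟶ twistObj p N where
  hom := p.aut.functor.map f.hom
  comm := ((twist p).map f).comm

/-- Naturality of the braiding carries `λ⁻¹` to the other side, and `a` being braided turns the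
braiding of the images into the image of the braiding. The left action is thus twisted exactly as
the right one, which is what makes twisting compatible with `⊗_A`. -/
lemma twistObj_lact (p : AutPair A) (M : RMod A) : (twistObj p M).lact =
    p.lam.iso.inv ▷ p.aut.functor.obj M.X ≫ Functor.LaxMonoidal.μ p.aut.functor A M.X ≫
      p.aut.functor.map M.lact := by
  rw [RMod.lact, RMod.lact, Functor.map_comp, Functor.LaxBraided.braided_assoc]
  simp

/-- The inner braiding is absorbed by `twistObj_lact`, the outer one by braidedness of `a` once
more. Both sides of the locality equation of the twist thereby acquire the same invertible prefix.
-/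
lemma braiding_braiding_twistObj_act (p : AutPair A) (M : RMod A) :
    (β_ (p.aut.functor.obj M.X) A).hom ≫ (β_ A (p.aut.functor.obj M.X)).hom ≫
        (twistObj p M).act =
      p.aut.functor.obj M.X ◁ p.lam.iso.inv ≫ Functor.LaxMonoidal.μ p.aut.functor M.X A ≫
        p.aut.functor.map ((β_ M.X A).hom ≫ (β_ A M.X).hom ≫ M.act) := by
  change _ ≫ (twistObj p M).lact = _
  rw [twistObj_lact, Functor.map_comp, Functor.LaxBraided.braided_assoc]
  simp [RMod.lact]

/-- After the invertible prefix is cancelled, what remains is the locality equation of `M` under the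
faithful functor `a`. The forward implication is what later gives essential surjectivity on local
modules. -/
lemma isLocal_twistObj_iff (p : AutPair A) (M : RMod A) :
    (twistObj p M).IsLocal ↔ M.IsLocal := by
  unfold RMod.IsLocal
  rw [braiding_braiding_twistObj_act, cancel_epi, cancel_epi]
  exact p.aut.functor.map_injective.eq_iff

/-- Twisting restricts to local modules. -/
def twistLoc (p : AutPair A) : LocMod A ⥤ LocMod A :=
  (isLocal A).lift ((isLocal A).ι ⋙ twist p) fun M => (isLocal_twistObj_iff p M.obj).2 M.property

instance (p : AutPair A) : (twist p).Faithful where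
  map_injective {M N f g} h := by
    ext
    exact p.aut.functor.map_injective (congrArg RMod.Hom.hom h)

instance (p : AutPair A) : (twist p).Full where
  map_surjective {M N} f := by
    obtain ⟨g, hg⟩ := p.aut.functor.map_surjective f.hom
    refine ⟨⟨g, p.aut.functor.map_injective ?_⟩, RMod.hom_ext hg⟩
    -- Precomposed with the isomorphisms `ψ` and `id ⊗ λ⁻¹`, the image under `a` of the linearity of
    -- `g` is the linearity of `f` for the twisted actions.
    rw [← cancel_epi (Functor.LaxMonoidal.μ p.aut.functor M.X A), ← cancel_epi (_ ◁ p.lam.iso.inv)]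
    have h : (p.aut.functor.obj M.X ◁ p.lam.iso.inv ≫ Functor.LaxMonoidal.μ p.aut.functor M.X A ≫
        p.aut.functor.map M.act) ≫ p.aut.functor.map g =
        p.aut.functor.map g ▷ A ≫ p.aut.functor.obj N.X ◁ p.lam.iso.inv ≫
          Functor.LaxMonoidal.μ p.aut.functor N.X A ≫ p.aut.functor.map N.act := by
      rw [hg]; exact f.comm
    simpa [← whisker_exchange_assoc] using h

/-- The module structure on a preimage of the object underlying `N`. -/
noncomputable def untwist (p : AutPair A) (N : RMod A) (X : C) (e : p.aut.functor.obj X ≅ N.X) :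
    RMod A :=
  -- This choice is forced: the twist of `r` must become `N.act` under `e`, so `r` contains `λ` and
  -- `δ` to cancel the `λ⁻¹` and `μ` in the definition of the twist. The module axioms are then
  -- checked after the faithful functor `a`, where they follow from those of `N` because `λ`
  -- respects units and multiplications.
  let r : X ⊗ A ⟶ X := p.aut.functor.preimage
    (δ p.aut.functor X A ≫ (e.hom ⊗ₘ p.lam.iso.hom) ≫ N.act ≫ e.inv)
  have hr : Functor.LaxMonoidal.μ p.aut.functor X A ≫ p.aut.functor.map r =
      (e.hom ⊗ₘ p.lam.iso.hom) ≫ N.act ≫ e.inv := by simp [r]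
  { X := X
    act := r
    act_one := by
      apply p.aut.functor.map_injective
      have h : (ε p.aut.functor ≫ p.aut.functor.map η[A]) ≫ p.lam.iso.hom = η[A] :=
        p.lam.isMonHom.one_hom
      rw [← cancel_epi (Functor.LaxMonoidal.μ p.aut.functor X (𝟙_ C)),
        ← cancel_epi (_ ◁ ε p.aut.functor), ← Functor.LaxMonoidal.right_unitality,
        Functor.map_comp, ← μ_natural_right_assoc, hr, MonoidalCategory.tensorHom_def',
        Category.assoc, ← MonoidalCategory.whiskerLeft_comp_assoc,
        ← MonoidalCategory.whiskerLeft_comp_assoc, h, whisker_exchange_assoc,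
        reassoc_of% N.act_one]
      simp
    act_mul := by
      apply p.aut.functor.map_injective
      have h : (Functor.LaxMonoidal.μ p.aut.functor A A ≫ p.aut.functor.map μ[A]) ≫
        p.lam.iso.hom = (p.lam.iso.hom ⊗ₘ p.lam.iso.hom) ≫ μ[A] := p.lam.isMonHom.mul_hom
      rw [← cancel_epi (Functor.LaxMonoidal.μ p.aut.functor X (A ⊗ A)),
        ← cancel_epi (_ ◁ Functor.LaxMonoidal.μ p.aut.functor A A)]
      calc
        _ = (e.hom ⊗ₘ ((Functor.LaxMonoidal.μ p.aut.functor A A ≫ p.aut.functor.map μ[A]) ≫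
            p.lam.iso.hom)) ≫ N.act ≫ e.inv := by
          rw [Functor.map_comp, ← μ_natural_right_assoc, hr]
          simp [MonoidalCategory.tensorHom_def']
        _ = (e.hom ⊗ₘ p.lam.iso.hom ⊗ₘ p.lam.iso.hom) ≫ N.X ◁ μ[A] ≫ N.act ≫ e.inv := by
          rw [h, ← id_tensorHom, tensorHom_comp_tensorHom_assoc, Category.comp_id]
        _ = (α_ _ _ _).inv ≫ (Functor.LaxMonoidal.μ p.aut.functor X A ≫ p.aut.functor.map r) ▷
            _ ≫ Functor.LaxMonoidal.μ p.aut.functor X A ≫ p.aut.functor.map r := by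
          rw [hr, reassoc_of% N.act_mul, associator_inv_naturality_assoc, ← tensorHom_id,
            ← tensorHom_id, tensorHom_comp_tensorHom_assoc, tensorHom_comp_tensorHom_assoc]
          simp
        _ = _ := by
          rw [Functor.map_comp, Functor.map_comp, Functor.LaxMonoidal.associativity_inv_assoc,
            comp_whiskerRight_assoc, μ_natural_left_assoc] }

/-- The twist of `untwist` is the given module. -/
noncomputable def twistUntwist (p : AutPair A) (N : RMod A) (X : C)
    (e : p.aut.functor.obj X ≅ N.X) : (twist p).obj (untwist p N X e) ≅ N :=
  RMod.isoMk e (by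
    change (p.aut.functor.obj X ◁ p.lam.iso.inv ≫ Functor.LaxMonoidal.μ p.aut.functor X A ≫
      p.aut.functor.map (p.aut.functor.preimage _)) ≫ e.hom = e.hom ▷ A ≫ N.act
    simp [MonoidalCategory.tensorHom_def'])

instance (p : AutPair A) : (twist p).EssSurj where
  mem_essImage N := ⟨_, ⟨twistUntwist p N _ (p.aut.functor.objObjPreimageIso N.X)⟩⟩

instance (p : AutPair A) : (twistLoc p).Faithful :=
  Functor.Faithful.of_comp_iso (H := (isLocal A).ι ⋙ twist p) (G := (isLocal A).ι) (Iso.refl _)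

instance (p : AutPair A) : (twistLoc p).Full :=
  Functor.Full.of_comp_faithful_iso (H := (isLocal A).ι ⋙ twist p) (G := (isLocal A).ι)
    (Iso.refl _)

lemma isLocal_of_iso {M N : RMod A} (e : M ≅ N) (h : M.IsLocal) : N.IsLocal := by
  have he : e.inv.hom ≫ e.hom.hom = 𝟙 _ := congrArg RMod.Hom.hom e.inv_hom_id
  have : N.act = e.inv.hom ▷ A ≫ M.act ≫ e.hom.hom := by
    rw [e.hom.comm, ← comp_whiskerRight_assoc, he]; simp
  unfold RMod.IsLocal at *
  rw [this, ← BraidedCategory.braiding_naturality_right_assoc,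
    ← BraidedCategory.braiding_naturality_left_assoc, reassoc_of% h]

/-- A preimage exists among all modules; its twist is isomorphic to a local module, so the preimage
is itself local since twisting reflects locality. -/
instance (p : AutPair A) : (twistLoc p).EssSurj where
  mem_essImage N := by
    let e := (twist p).objObjPreimageIso N.obj
    have h := (isLocal_twistObj_iff p _).1 (isLocal_of_iso e.symm N.property)
    exact ⟨⟨_, h⟩, ⟨(isLocal A).isoMk e⟩⟩

instance (p : AutPair A) : (twistLoc p).IsEquivalence where

end Twist

/-! ### Compatibility of twisting with the relative tensor product. -/

section TwistTensor

variable {C : Type u} [Category.{v} C] [Preadditive C] [Linear ℂ C] [MonoidalCategory C]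
  [BraidedCategory C] [HasCoequalizers C]
  [∀ Z : C, PreservesColimitsOfShape WalkingParallelPair (tensorLeft Z)]
  {A : C} [MonObj A] [IsCommMonObj A]

open RMod

/-- This is the image under `a` of the balancing relation for `M ⊗_A N`: naturality of `ψ` brings
both actions inside `a`, its associativity compares the two bracketings, and the same `λ⁻¹` occurs
on both sides. -/
lemma twist_tensor_balanced (p : AutPair A) (M N : RMod A) :
    (twistObj p M).act ▷ p.aut.functor.obj N.X ≫ Functor.LaxMonoidal.μ p.aut.functor M.X N.X ≫
        p.aut.functor.map (proj M N) =
      (α_ _ _ _).hom ≫ p.aut.functor.obj M.X ◁ (twistObj p N).lact ≫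
        Functor.LaxMonoidal.μ p.aut.functor M.X N.X ≫ p.aut.functor.map (proj M N) := by
  have b := congrArg p.aut.functor.map (proj_balanced M N)
  simp only [Functor.map_comp] at b
  rw [twistObj_lact]
  simp only [comp_whiskerRight, MonoidalCategory.whiskerLeft_comp, Category.assoc,
    μ_natural_left_assoc, μ_natural_right_assoc, b]
  rw [Functor.LaxMonoidal.associativity_assoc, associator_naturality_middle_assoc]

/-- The tensorator of the twist, induced by the tensorator of the autoequivalence. -/
noncomputable def twistTensorHom (p : AutPair A) (M N : RMod A) :
    tens (twistObj p M) (twistObj p N) ⟶ twistObj p (tens M N) where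
  hom := desc (Functor.LaxMonoidal.μ p.aut.functor M.X N.X ≫ p.aut.functor.map (proj M N))
    (twist_tensor_balanced p M N)
  comm := by
    rw [← cancel_epi (proj (twistObj p M) (twistObj p N) ▷ A), ← Category.assoc, proj_act,
      ← comp_whiskerRight_assoc, proj_desc]
    have b := congrArg p.aut.functor.map (proj_act M N)
    simp only [Functor.map_comp] at b
    simp only [Category.assoc, proj_desc, comp_whiskerRight, MonoidalCategory.whiskerLeft_comp,
      μ_natural_right_assoc]
    rw [← whisker_exchange_assoc, μ_natural_left_assoc, b, ← whisker_exchange_assoc,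
      Functor.LaxMonoidal.associativity_assoc]
    simp

@[simp] lemma proj_twistTensorHom (p : AutPair A) (M N : RMod A) :
    proj (twistObj p M) (twistObj p N) ≫ (twistTensorHom p M N).hom =
      Functor.LaxMonoidal.μ p.aut.functor M.X N.X ≫ p.aut.functor.map (proj M N) :=
  proj_desc _ (twist_tensor_balanced p M N)

@[simp] lemma proj_twistTensorHom_assoc (p : AutPair A) (M N : RMod A) {Q : C}
    (k : p.aut.functor.obj (tens M N).X ⟶ Q) :
    proj (twistObj p M) (twistObj p N) ≫ (twistTensorHom p M N).hom ≫ k =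
      Functor.LaxMonoidal.μ p.aut.functor M.X N.X ≫ p.aut.functor.map (proj M N) ≫ k := by
  rw [← Category.assoc, proj_twistTensorHom, Category.assoc]

/-- The inverse of the tensorator of the twist, as a morphism of underlying objects. -/
noncomputable def twistTensorInv (p : AutPair A) (M N : RMod A) :
    p.aut.functor.obj (tens M N).X ⟶ (tens (twistObj p M) (twistObj p N)).X :=
  Cofork.IsColimit.desc (isColimitOfHasCoequalizerOfPreservesColimit p.aut.functor
    (M.act ▷ N.X) ((α_ M.X A N.X).hom ≫ M.X ◁ N.lact))
    (δ p.aut.functor M.X N.X ≫ proj (twistObj p M) (twistObj p N)) (by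
    have b := proj_balanced (twistObj p M) (twistObj p N)
    rw [twistObj_lact] at b
    -- All three maps are invertible. Composing with them reassembles the twisted actions of `A`, so
    -- the condition becomes the balancing relation `b` for the twisted modules.
    rw [← cancel_epi (Functor.LaxMonoidal.μ p.aut.functor (M.X ⊗ A) N.X),
      ← cancel_epi (Functor.LaxMonoidal.μ p.aut.functor M.X A ▷ _),
      ← cancel_epi ((p.aut.functor.obj M.X ◁ p.lam.iso.inv) ▷ _)]
    simp only [← μ_natural_left_assoc, ← μ_natural_right_assoc, Functor.map_comp, Category.assoc,
      Functor.LaxMonoidal.associativity_assoc, Functor.Monoidal.μ_δ_assoc]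
    simp only [comp_whiskerRight, MonoidalCategory.whiskerLeft_comp, Category.assoc] at b
    rw [b, associator_naturality_middle_assoc])

@[simp] lemma map_proj_twistTensorInv (p : AutPair A) (M N : RMod A) :
    p.aut.functor.map (proj M N) ≫ twistTensorInv p M N =
      δ p.aut.functor M.X N.X ≫ proj (twistObj p M) (twistObj p N) :=
  Cofork.IsColimit.π_desc' (isColimitOfHasCoequalizerOfPreservesColimit p.aut.functor
    (M.act ▷ N.X) ((α_ M.X A N.X).hom ≫ M.X ◁ N.lact)) _ _

/-- The tensorator of the twist. -/
noncomputable def twistTensorIso (p : AutPair A) (M N : RMod A) :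
    tens (twistObj p M) (twistObj p N) ≅ twistObj p (tens M N) :=
  isoMk { hom := (twistTensorHom p M N).hom
          inv := twistTensorInv p M N
          hom_inv_id := by rw [← cancel_epi (proj _ _)]; simp
          inv_hom_id := by
            rw [← cancel_epi (p.aut.functor.map (proj M N)), ← Category.assoc]; simp }
    (twistTensorHom p M N).comm

/-- The unit constraint of the twist. -/
def twistUnitIso (p : AutPair A) : regular A ≅ twistObj p (regular A) :=
  isoMk p.lam.iso.symm (by
    have h : (Functor.LaxMonoidal.μ p.aut.functor A A ≫ p.aut.functor.map μ[A]) ≫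
      p.lam.iso.hom = (p.lam.iso.hom ⊗ₘ p.lam.iso.hom) ≫ μ[A] := p.lam.isMonHom.mul_hom
    -- Multiplicativity of `λ` is exactly the statement that `λ⁻¹` is a module map from `A` to its
    -- twist.
    rw [Iso.symm_hom, Iso.comp_inv_eq, Category.assoc, Category.assoc, h,
      MonoidalCategory.tensorHom_def']
    simp)

@[simp] lemma twistUnitIso_hom_hom (p : AutPair A) : (twistUnitIso p).hom.hom = p.lam.iso.inv :=
  rfl

lemma tensMap_twistTensorHom (p : AutPair A) {M M' N N' : RMod A} (f : M ⟶ M') (g : N ⟶ N') :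
    tensMap (twistMap p f) (twistMap p g) ≫ twistTensorHom p M' N' =
      twistTensorHom p M N ≫ twistMap p (tensMap f g) := by
  apply tens_ext
  simp only [comp_hom, proj_tensMap_assoc, proj_twistTensorHom, proj_twistTensorHom_assoc,
    μ_natural_assoc, ← Functor.map_comp, proj_tensMap]

/-- On the triple tensor product in `C` both associators are induced by the one of `C`, so the claim
reduces to associativity of `ψ` followed by `a` of the iterated projection. -/
lemma twistTensorHom_assoc (p : AutPair A) (M N P : RMod A) :
    tensMap (twistTensorHom p M N) (𝟙 (twistObj p P)) ≫ twistTensorHom p (tens M N) P ≫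
        twistMap p (assoc M N P).hom =
      (assoc (twistObj p M) (twistObj p N) (twistObj p P)).hom ≫
        tensMap (𝟙 (twistObj p M)) (twistTensorHom p N P) ≫ twistTensorHom p M (tens N P) := by
  apply tens_ext₃
  have b := congrArg p.aut.functor.map (proj_assoc M N P)
  simp only [Functor.map_comp] at b
  have d := proj_assoc (twistObj p M) (twistObj p N) (twistObj p P)
  simp only [comp_hom, proj_tensMap_assoc, proj_twistTensorHom_assoc, id_hom, tensorHom_id]
  rw [reassoc_of% d, proj_tensMap_assoc, proj_twistTensorHom, id_hom, id_tensorHom,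
    ← comp_whiskerRight_assoc, ← MonoidalCategory.whiskerLeft_comp_assoc, proj_twistTensorHom,
    proj_twistTensorHom]
  simp only [comp_whiskerRight, MonoidalCategory.whiskerLeft_comp, Category.assoc,
    μ_natural_left_assoc, μ_natural_right_assoc, b, Functor.LaxMonoidal.associativity_assoc]

/-- The left unitor is induced by the left action, so after projecting this is the formula
`twistObj_lact`. -/
lemma twist_left_unitality (p : AutPair A) (M : RMod A) :
    (lUnitor (twistObj p M)).hom = tensMap (twistUnitIso p).hom (𝟙 (twistObj p M)) ≫
      twistTensorHom p (regular A) M ≫ twistMap p (lUnitor M).hom := by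
  apply tens_ext
  simp only [comp_hom, proj_tensMap_assoc, proj_twistTensorHom_assoc, proj_lUnitor,
    ← Functor.map_comp, twistObj_lact, id_hom, tensorHom_id, twistUnitIso_hom_hom]

/-- The right unitor is induced by the right action, so after projecting this is the very definition
of the twisted action. -/
lemma twist_right_unitality (p : AutPair A) (M : RMod A) :
    (rUnitor (twistObj p M)).hom = tensMap (𝟙 (twistObj p M)) (twistUnitIso p).hom ≫
      twistTensorHom p M (regular A) ≫ twistMap p (rUnitor M).hom := by
  apply tens_ext
  simp only [comp_hom, proj_tensMap_assoc, proj_twistTensorHom_assoc, proj_rUnitor,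
    ← Functor.map_comp, id_hom, id_tensorHom, twistUnitIso_hom_hom]

lemma twistTensorHom_braid (p : AutPair A) (M N : RMod A) (hM : M.IsLocal)
    (hM' : (twistObj p M).IsLocal) :
    twistTensorHom p M N ≫ twistMap p (braid M N hM).hom =
      (braid (twistObj p M) (twistObj p N) hM').hom ≫ twistTensorHom p N M := by
  apply tens_ext
  have b := congrArg p.aut.functor.map (proj_braid M N hM)
  simp only [Functor.map_comp] at b
  simp only [comp_hom, reassoc_of% proj_braid, proj_twistTensorHom_assoc, proj_twistTensorHom, b,
    Functor.LaxBraided.braided_assoc]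

end TwistTensor

/-! ### The twist as a braided autoequivalence of the local modules. -/

section TwistLocal

variable {C : Type u} [Category.{v} C] [Preadditive C] [Linear ℂ C] [MonoidalCategory C]
  [MonoidalPreadditive C] [MonoidalLinear ℂ C]
  [BraidedCategory C] [HasCoequalizers C]
  [∀ Z : C, PreservesColimitsOfShape WalkingParallelPair (tensorLeft Z)]
  {A : C} [MonObj A] [IsCommMonObj A]

open RMod

/-- The monoidal structure on the twisting functor on local modules. -/
noncomputable instance (p : AutPair A) : (twistLoc p).Monoidal :=
  Functor.CoreMonoidal.toMonoidal
    { εIso := (isLocal A).isoMk (twistUnitIso p)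
      μIso := fun M N => (isLocal A).isoMk (twistTensorIso p M.obj N.obj)
      μIso_hom_natural_left := fun {M N} f P => by
        apply ObjectProperty.hom_ext
        change tensMap (twistMap p f.hom) (𝟙 (twistObj p P.obj)) ≫ twistTensorHom p _ _ =
          twistTensorHom p _ _ ≫ twistMap p (tensMap f.hom (𝟙 P.obj))
        rw [← tensMap_twistTensorHom]
        congr 2
        exact ((twist p).map_id _).symm
      μIso_hom_natural_right := fun {M N} P f => by
        apply ObjectProperty.hom_ext
        change tensMap (𝟙 (twistObj p P.obj)) (twistMap p f.hom) ≫ twistTensorHom p _ _ =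
          twistTensorHom p _ _ ≫ twistMap p (tensMap (𝟙 P.obj) f.hom)
        rw [← tensMap_twistTensorHom]
        congr 2
        exact ((twist p).map_id _).symm
      associativity := fun M N P =>
        ObjectProperty.hom_ext _ (twistTensorHom_assoc p M.obj N.obj P.obj)
      left_unitality := fun M => ObjectProperty.hom_ext _ (twist_left_unitality p M.obj)
      right_unitality := fun M => ObjectProperty.hom_ext _ (twist_right_unitality p M.obj) }

noncomputable instance (p : AutPair A) : (twistLoc p).Braided where
  braided M N := ObjectProperty.hom_ext _ (twistTensorHom_braid p M.obj N.obj M.property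
    ((twistLoc p).obj M).property)

instance (p : AutPair A) : (twistLoc p).Additive where
  map_add {M N f g} := by
    apply ObjectProperty.hom_ext
    apply RMod.hom_ext
    exact p.aut.functor.map_add (f := f.hom.hom) (g := g.hom.hom)

instance (p : AutPair A) : (twistLoc p).Linear ℂ where
  map_smul {M N} f c := by
    apply ObjectProperty.hom_ext
    apply RMod.hom_ext
    exact Functor.Linear.map_smul (F := p.aut.functor) f.hom.hom c

/-- Twisting by a pair, as a braided autoequivalence of the category of local modules. -/
noncomputable def twistAut (p : AutPair A) : AutBr (LocMod A) where
  functor := twistLoc p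
  braided := inferInstance
  isEquivalence := inferInstance
  additive := inferInstance
  linear := inferInstance

/-- A natural isomorphism of twists with prescribed underlying components is monoidal if the
components are compatible with the constraints of the autoequivalences. -/
lemma isMonoidal_twist {p q : AutPair A} (t : twistLoc p ⟶ twistLoc q)
    (hu : p.lam.iso.inv ≫ (t.app (𝟙_ _)).hom.hom = q.lam.iso.inv)
    (h : ∀ M N : LocMod A, Functor.LaxMonoidal.μ p.aut.functor M.obj.X N.obj.X ≫
      p.aut.functor.map (proj M.obj N.obj) ≫ (t.app (M ⊗ N)).hom.hom =
        ((t.app M).hom.hom ⊗ₘ (t.app N).hom.hom) ≫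
          Functor.LaxMonoidal.μ q.aut.functor M.obj.X N.obj.X ≫
            q.aut.functor.map (proj M.obj N.obj)) : NatTrans.IsMonoidal t where
  unit := by
    apply ObjectProperty.hom_ext
    apply RMod.hom_ext
    exact hu
  tensor M N := by
    apply ObjectProperty.hom_ext
    refine tens_ext (M := twistObj p M.obj) (N := twistObj p N.obj) ?_
    change _ ≫ (twistTensorHom p M.obj N.obj).hom ≫ _ =
      _ ≫ (tensMap (t.app M).hom (t.app N).hom).hom ≫ (twistTensorHom q M.obj N.obj).hom
    refine (proj_twistTensorHom_assoc p M.obj N.obj _).trans ?_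
    refine (h M N).trans ?_
    refine Eq.trans ?_ (proj_tensMap_assoc (M := twistObj p M.obj) (M' := twistObj q M.obj)
      (N := twistObj p N.obj) (N' := twistObj q N.obj) (t.app M).hom (t.app N).hom _).symm
    exact congrArg (_ ≫ ·) (proj_twistTensorHom q M.obj N.obj).symm

end TwistLocal

/-! ### Twisting as a strong monoidal functor of the pair. -/

section TwistFunctor

variable {C : Type u} [Category.{v} C] [Preadditive C] [Linear ℂ C] [MonoidalCategory C]
  [MonoidalPreadditive C] [MonoidalLinear ℂ C]
  [BraidedCategory C] [HasCoequalizers C]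
  [∀ Z : C, PreservesColimitsOfShape WalkingParallelPair (tensorLeft Z)]
  {A : C} [MonObj A] [IsCommMonObj A]

open RMod

/-- The compatibility condition on morphisms of pairs, in terms of the inverses that enter both the
twisted action and the unit constraint. -/
lemma lam_inv_app {p q : AutPair A} (f : p ⟶ q) :
    p.lam.iso.inv ≫ AutBr.app f.hom A = q.lam.iso.inv := by
  rw [Iso.inv_comp_eq, ← f.comm, Category.assoc, Iso.hom_inv_id, Category.comp_id]

/-- A morphism of pairs induces isomorphisms between twists. -/
def twistAppIso {p q : AutPair A} (f : p ⟶ q) (M : RMod A) : twistObj p M ≅ twistObj q M :=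
  RMod.isoMk ((AutBr.Hom.iso f.hom).app M.X) (by
    have ht := NatTrans.IsMonoidal.tensor (τ := (AutBr.Hom.iso f.hom).hom) M.X A
    have hn := AutBr.app_naturality f.hom M.act
    change (_ ◁ _ ≫ _ ≫ _) ≫ AutBr.app f.hom M.X = AutBr.app f.hom M.X ▷ A ≫ _ ◁ _ ≫ _ ≫ _
    -- Monoidality of `η` splits `η` at `M ⊗ A` into its components at `M` and at `A`; the one at
    -- `A` turns the inverse algebra isomorphism of `p` into that of `q`.
    rw [Category.assoc, Category.assoc, hn, reassoc_of% ht, ← lam_inv_app f,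
      MonoidalCategory.tensorHom_def']
    simp [← whisker_exchange_assoc])

/-- A morphism of pairs induces a natural isomorphism between twists of local modules. -/
def twistNatIso {p q : AutPair A} (f : p ⟶ q) : twistLoc p ≅ twistLoc q :=
  NatIso.ofComponents (fun M => (isLocal A).isoMk (twistAppIso f M.obj)) (fun {M N} k => by
    apply ObjectProperty.hom_ext
    apply RMod.hom_ext
    exact AutBr.app_naturality f.hom k.hom.hom)

/-- The monoidal natural isomorphism of twists induced by a morphism of pairs. -/
def twistAutMap {p q : AutPair A} (f : p ⟶ q) : twistAut p ⟶ twistAut q :=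
  ⟨twistNatIso f, isMonoidal_twist _ (lam_inv_app f) fun M N => by
    have ht := NatTrans.IsMonoidal.tensor (τ := (AutBr.Hom.iso f.hom).hom) M.obj.X N.obj.X
    have hn := AutBr.app_naturality f.hom (proj M.obj N.obj)
    change _ ≫ _ ≫ AutBr.app f.hom _ = (AutBr.app f.hom M.obj.X ⊗ₘ AutBr.app f.hom N.obj.X) ≫ _
    rw [hn, reassoc_of% ht]
    rfl⟩

variable (A) in
/-- Twisting, as a functor from pairs to braided autoequivalences of local modules. -/
noncomputable def twistFunctor : AutPair A ⥤ AutBr (LocMod A) where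
  obj := twistAut
  map := twistAutMap
  map_id p := by
    apply AutBr.hom_ext
    intro M
    rfl
  map_comp f g := by
    apply AutBr.hom_ext
    intro M
    rfl

/-- The algebra isomorphism of the composite is `λ ∘ a(κ)`, with inverse `λ⁻¹` followed by `a(κ⁻¹)`;
naturality of the tensorator of `a` moves the latter inside `a`. The actions agree strictly, so an
identity morphism can compare the two modules. -/
lemma comp_twistObj_act (p q : AutPair A) (M : RMod A) :
    (twistObj p (twistObj q M)).act = (twistObj (p ⊗ q) M).act := by
  change p.aut.functor.obj (q.aut.functor.obj M.X) ◁ p.lam.iso.inv ≫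
    Functor.LaxMonoidal.μ p.aut.functor (q.aut.functor.obj M.X) A ≫
      p.aut.functor.map (q.aut.functor.obj M.X ◁ q.lam.iso.inv ≫
        Functor.LaxMonoidal.μ q.aut.functor M.X A ≫ q.aut.functor.map M.act) =
    p.aut.functor.obj (q.aut.functor.obj M.X) ◁
      (p.lam.iso.inv ≫ p.aut.functor.map q.lam.iso.inv) ≫
        (Functor.LaxMonoidal.μ p.aut.functor _ _ ≫
          p.aut.functor.map (Functor.LaxMonoidal.μ q.aut.functor M.X A)) ≫
            p.aut.functor.map (q.aut.functor.map M.act)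
  simp

/-- The composite of two twists is the twist by the composite. -/
def twistCompIso (p q : AutPair A) : twistLoc q ⋙ twistLoc p ≅ twistLoc (p ⊗ q) :=
  NatIso.ofComponents (fun M => (isLocal A).isoMk
    (RMod.isoMk (M := twistObj p (twistObj q M.obj)) (N := twistObj (p ⊗ q) M.obj)
      (Iso.refl _) (by
        rw [comp_twistObj_act]
        simp))) (fun {M N} k => by
    apply ObjectProperty.hom_ext
    apply RMod.hom_ext
    exact (Category.comp_id _).trans (Category.id_comp _).symm)

/-- On projections both tensorators equal the tensorator of the composite autoequivalence followed
by the image of the projection under both functors. -/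
lemma isMonoidal_twistCompIso (p q : AutPair A) :
    NatTrans.IsMonoidal (twistCompIso p q).hom where
  unit := by
    apply ObjectProperty.hom_ext
    apply RMod.hom_ext
    exact Category.comp_id _
  tensor M N := by
    apply ObjectProperty.hom_ext
    refine tens_ext (M := twistObj p (twistObj q M.obj)) (N := twistObj p (twistObj q N.obj)) ?_
    change proj (twistObj p (twistObj q M.obj)) (twistObj p (twistObj q N.obj)) ≫
      ((twistTensorHom p (twistObj q M.obj) (twistObj q N.obj)).hom ≫
        p.aut.functor.map (twistTensorHom q M.obj N.obj).hom) ≫ 𝟙 _ =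
      proj (twistObj p (twistObj q M.obj)) (twistObj p (twistObj q N.obj)) ≫
        (tensMap ((twistCompIso p q).hom.app M).hom ((twistCompIso p q).hom.app N).hom).hom ≫
          (twistTensorHom (p ⊗ q) M.obj N.obj).hom
    refine Eq.trans ?_ (proj_tensMap_assoc (M := twistObj p (twistObj q M.obj))
      (M' := twistObj (p ⊗ q) M.obj) (N := twistObj p (twistObj q N.obj))
      (N' := twistObj (p ⊗ q) N.obj) _ _ _).symm
    change _ = (𝟙 _ ⊗ₘ 𝟙 _) ≫ _
    rw [proj_twistTensorHom, Category.comp_id, proj_twistTensorHom_assoc, ← Functor.map_comp,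
      proj_twistTensorHom]
    change _ = (𝟙 _ ⊗ₘ 𝟙 _) ≫ (Functor.LaxMonoidal.μ p.aut.functor _ _ ≫
          p.aut.functor.map (Functor.LaxMonoidal.μ q.aut.functor _ _)) ≫
            p.aut.functor.map (q.aut.functor.map _)
    simp

/-- The twist by the identity is the identity. -/
def twistOneIso : 𝟭 (LocMod A) ≅ twistLoc (𝟙_ (AutPair A)) :=
  NatIso.ofComponents (fun M => (isLocal A).isoMk
    (RMod.isoMk (M := M.obj) (N := twistObj (𝟙_ (AutPair A)) M.obj) (Iso.refl _) (by
        change M.obj.act ≫ 𝟙 _ = 𝟙 _ ▷ A ≫ M.obj.X ◁ 𝟙 A ≫ 𝟙 _ ≫ M.obj.act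
        simp))) (fun {M N} k => by
    apply ObjectProperty.hom_ext
    apply RMod.hom_ext
    exact (Category.comp_id _).trans (Category.id_comp _).symm)

lemma isMonoidal_twistOneIso : NatTrans.IsMonoidal (twistOneIso (A := A)).hom where
  unit := by
    apply ObjectProperty.hom_ext
    apply RMod.hom_ext
    exact Category.comp_id _
  tensor M N := by
    apply ObjectProperty.hom_ext
    refine tens_ext (M := M.obj) (N := N.obj) ?_
    change proj M.obj N.obj ≫ 𝟙 _ ≫ 𝟙 _ = proj M.obj N.obj ≫
        (tensMap (twistOneIso.hom.app M).hom (twistOneIso.hom.app N).hom).hom ≫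
          (twistTensorHom (𝟙_ (AutPair A)) M.obj N.obj).hom
    refine Eq.trans ?_ (proj_tensMap_assoc (M := M.obj)
      (M' := twistObj (𝟙_ (AutPair A)) M.obj) (N := N.obj)
      (N' := twistObj (𝟙_ (AutPair A)) N.obj) _ _ _).symm
    rw [proj_twistTensorHom]
    change _ = (𝟙 _ ⊗ₘ 𝟙 _) ≫ 𝟙 _ ≫ proj M.obj N.obj
    simp

/-- All constraints have identity components, so each coherence law reduces to the preservation of
identities by the autoequivalences. -/
noncomputable instance : (twistFunctor A).Monoidal :=
  Functor.CoreMonoidal.toMonoidal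
    { εIso := AutBr.isoMk (a := AutBr.one (LocMod A)) (b := twistAut (𝟙_ (AutPair A)))
        twistOneIso isMonoidal_twistOneIso
      μIso := fun p q => AutBr.isoMk (a := AutBr.comp (twistAut p) (twistAut q))
        (b := twistAut (p ⊗ q)) (twistCompIso p q) (isMonoidal_twistCompIso p q)
      μIso_hom_natural_left := fun {p q} f r => by
        apply AutBr.hom_ext
        intro M
        apply ObjectProperty.hom_ext
        apply RMod.hom_ext
        exact (Category.comp_id _).trans (Category.id_comp _).symm
      μIso_hom_natural_right := fun {p q} r f => by
        apply AutBr.hom_ext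
        intro M
        apply ObjectProperty.hom_ext
        apply RMod.hom_ext
        exact (Category.comp_id _).trans (Category.id_comp _).symm
      associativity := fun p q r => by
        apply AutBr.hom_ext
        intro M
        apply ObjectProperty.hom_ext
        apply RMod.hom_ext
        change 𝟙 _ ≫ 𝟙 _ ≫ 𝟙 _ = 𝟙 _ ≫ p.aut.functor.map (𝟙 _) ≫ 𝟙 _
        simp
      left_unitality := fun p => by
        apply AutBr.hom_ext
        intro M
        apply ObjectProperty.hom_ext
        apply RMod.hom_ext
        change 𝟙 _ = 𝟙 _ ≫ 𝟙 _ ≫ 𝟙 _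
        simp
      right_unitality := fun p => by
        apply AutBr.hom_ext
        intro M
        apply ObjectProperty.hom_ext
        apply RMod.hom_ext
        change 𝟙 _ = p.aut.functor.map (𝟙 _) ≫ 𝟙 _ ≫ 𝟙 _
        simp }

variable (A) in
/-- Twisting, as a strong monoidal functor. -/
noncomputable def twistStrong : StrongMonoidalFunctor (AutPair A) (AutBr (LocMod A)) :=
  ⟨twistFunctor A, inferInstance⟩

/-- The twisting functor on local modules is the restriction of `twist`. -/
noncomputable def twistIso (p : AutPair A) : TwistIso p (twistAut p) where
  iso := Iso.refl _
  tensor M N := by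
    change proj (twistObj p M.obj) (twistObj p N.obj) ≫
      (twistTensorHom p M.obj N.obj).hom ≫ 𝟙 _ = (𝟙 _ ⊗ₘ 𝟙 _) ≫ _
    rw [Category.comp_id, proj_twistTensorHom, id_tensorHom_id]
    exact (Category.id_comp _).symm
  unit := Category.comp_id _

variable (A) in
/-- The identifications of the strong monoidal functor `twistStrong` with twisting. -/
noncomputable def twistFunctorData : TwistFunctorData (twistStrong A) where
  tw := twistIso
  map f M := (Category.comp_id _).trans (Category.id_comp _).symm
  tensor p q M := by
    change 𝟙 _ ≫ 𝟙 _ = 𝟙 _ ≫ p.aut.functor.map (𝟙 _)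
    simp
  unit M := Category.comp_id _

end TwistFunctor

/-! ### Lifts of an action and equivariant algebra structures. -/

/-- Strong monoidal structures on a functor are determined by their lax part. -/
lemma StrongMonoidalFunctor.ext_of_lax {𝒢 : Type*} [Category* 𝒢] [MonoidalCategory 𝒢]
    {ℋ : Type*} [Category* ℋ] [MonoidalCategory ℋ] {F : 𝒢 ⥤ ℋ} (m m' : F.Monoidal)
    (hε : m.ε = m'.ε) (hμ : ∀ X Y, m.μ X Y = m'.μ X Y) :
    (⟨F, m⟩ : StrongMonoidalFunctor 𝒢 ℋ) = ⟨F, m'⟩ := by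
  congr 1
  refine Functor.Monoidal.ext hε (by funext X Y; exact hμ X Y) ?_ ?_
  -- The oplax constraints are two-sided inverses of the lax ones, and inverses are unique.
  · have : IsIso m.ε := (@Functor.Monoidal.εIso _ _ _ _ _ _ F m).isIso_hom
    rw [← cancel_epi m.ε]
    exact m.ε_η.trans (by rw [hε]; exact m'.ε_η.symm)
  · funext X Y
    have : IsIso (m.μ X Y) := (@Functor.Monoidal.μIso _ _ _ _ _ _ F m X Y).isIso_hom
    rw [← cancel_epi (m.μ X Y)]
    exact (m.μ_δ X Y).trans (by rw [hμ]; exact (m'.μ_δ X Y).symm)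

section Lifts

variable {C : Type u} [Category.{v} C] [Preadditive C] [Linear ℂ C] [MonoidalCategory C]
  [BraidedCategory C] {A : C} [MonObj A] {G : Type w} [Group G]

namespace CatAction

namespace EquivariantAlgebra

variable {ρ : CatAction G C}

lemma map_lam (l : ρ.EquivariantAlgebra A) {X Y : Discrete G} (f : X ⟶ Y) :
    AutBr.app (ρ.toFunctor.map f) A ≫ (l.lam Y.as).iso.hom = (l.lam X.as).iso.hom := by
  obtain ⟨x⟩ := X
  obtain ⟨y⟩ := Y
  obtain rfl : x = y := Discrete.eq_of_hom f
  obtain rfl : f = 𝟙 _ := Subsingleton.elim _ _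
  rw [CategoryTheory.Functor.map_id, AutBr.id_app, Category.id_comp]

/-- Equivariance at `(1, 1)` forces normalization. Naturality of the unit constraint rewrites `λ^1 ≫
ε_A ≫ λ^1` as `ε ≫ ρ(1)(λ^1) ≫ λ^1`; equivariance makes this `ε ≫ μ_{1,1} ≫ λ^{1·1}`, which is `λ^1`
by left unitality. Cancelling the isomorphism `λ^1` gives the claim. The unitor of `Discrete G`
accounts for the passage from `1 * 1` to `1`. -/
lemma eps_lam (l : ρ.EquivariantAlgebra A) : ρ.eps A ≫ (l.lam 1).iso.hom = 𝟙 A := by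
  have e := l.equivariant 1 1
  have m := l.map_lam (λ_ (Discrete.mk (1 : G))).hom
  have n : (l.lam 1).iso.hom ≫ ρ.eps A =
    ρ.eps _ ≫ (ρ.aut 1).functor.map (l.lam 1).iso.hom := AutBr.app_naturality ρ.unit _
  have u : 𝟙 ((ρ.aut 1).functor.obj A) = ρ.eps ((ρ.aut 1).functor.obj A) ≫ ρ.mu 1 1 A ≫
      AutBr.app (ρ.toFunctor.map (λ_ (Discrete.mk (1 : G))).hom) A :=
    congrArg (fun t => AutBr.app t A)
      (Functor.LaxMonoidal.left_unitality ρ.toFunctor (Discrete.mk (1 : G)))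
  rw [← cancel_epi (l.lam 1).iso.hom, ← Category.assoc, n, Category.assoc, e, Category.comp_id,
    ← Category.id_comp (l.lam 1).iso.hom, u, Category.assoc, Category.assoc]
  exact congrArg (fun t => ρ.eps _ ≫ ρ.mu 1 1 A ≫ t) m.symm

/-- The functor to pairs attached to an equivariant algebra structure. -/
def liftFunctor (l : ρ.EquivariantAlgebra A) : Discrete G ⥤ AutPair A where
  obj g := ⟨ρ.aut g.as, l.lam g.as⟩
  map f := ⟨ρ.toFunctor.map f, l.map_lam f⟩
  map_id _ := AutPair.hom_ext (ρ.toFunctor.map_id _)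
  map_comp _ _ := AutPair.hom_ext (ρ.toFunctor.map_comp _ _)

/-- The constraints are those of `ρ`. They are morphisms of pairs by `eps_lam` and by equivariance,
and the coherence laws are inherited because a morphism of pairs is determined by its underlying
natural isomorphism. -/
instance (l : ρ.EquivariantAlgebra A) : l.liftFunctor.Monoidal :=
  Functor.CoreMonoidal.toMonoidal
    { εIso := AutPair.isoMk (a := AutPair.one A) (b := l.liftFunctor.obj (Discrete.mk 1))
        (Functor.Monoidal.εIso ρ.toFunctor) l.eps_lam
      μIso := fun X Y => AutPair.isoMk
        (a := AutPair.comp (l.liftFunctor.obj X) (l.liftFunctor.obj Y))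
        (b := l.liftFunctor.obj (X ⊗ Y))
        (Functor.Monoidal.μIso ρ.toFunctor X Y) (l.equivariant X.as Y.as).symm
      μIso_hom_natural_left := fun f X => AutPair.hom_ext (μ_natural_left ρ.toFunctor f X)
      μIso_hom_natural_right := fun X f => AutPair.hom_ext (μ_natural_right ρ.toFunctor X f)
      associativity := fun X Y Z => AutPair.hom_ext
        (Functor.LaxMonoidal.associativity ρ.toFunctor X Y Z)
      left_unitality := fun X => AutPair.hom_ext
        (Functor.LaxMonoidal.left_unitality ρ.toFunctor X)
      right_unitality := fun X => AutPair.hom_ext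
        (Functor.LaxMonoidal.right_unitality ρ.toFunctor X) }

/-- The lift attached to an equivariant algebra structure. -/
def toLift (l : ρ.EquivariantAlgebra A) : ρ.Lift A where
  lift := ⟨l.liftFunctor, inferInstance⟩
  comp_forget := by
    refine StrongMonoidalFunctor.ext_of_lax (F := ρ.toFunctor) _ ρ.monoidal ?_ ?_
    -- The forgetful functor has identity constraints, so composing with it returns the constraints
    -- of `ρ`.
    · exact Category.id_comp _
    · exact fun X Y => Category.id_comp _

@[ext]
lemma ext_lam {l l' : ρ.EquivariantAlgebra A} (h : ∀ g, l.lam g = l'.lam g) : l = l' := by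
  cases l
  cases l'
  congr
  exact funext h

end EquivariantAlgebra

namespace Lift

/-- Equivariance is the condition for the tensorator of `L` at `(X, Y)` to be a morphism of pairs;
the tensorator of the composite differs from it only by an identity. -/
lemma mu_lam (L : StrongMonoidalFunctor (Discrete G) (AutPair A)) (X Y : Discrete G) :
    (L.toFunctor.obj X).aut.functor.map (L.toFunctor.obj Y).lam.iso.hom ≫
        (L.toFunctor.obj X).lam.iso.hom =
      AutBr.app ((L.comp (AutPair.forget A)).tensorator X Y) A ≫
        (L.toFunctor.obj (X ⊗ Y)).lam.iso.hom := by
  have h : AutBr.app (L.tensorator X Y).hom A ≫ (L.toFunctor.obj (X ⊗ Y)).lam.iso.hom = _ :=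
    (L.tensorator X Y).comm
  refine h.symm.trans (congrArg (· ≫ _) ?_)
  exact congrArg (fun t => AutBr.app t A) (Category.id_comp (L.tensorator X Y).hom).symm

/-- The equivariant algebra structure underlying a lift. -/
def toEquivariantAlgebra {ρ : CatAction G C} : ρ.Lift A → ρ.EquivariantAlgebra A
  -- A lift satisfies an equality of strong monoidal functors, so the family, naturally attached to
  -- `L` composed with the forgetful functor, is transported to `ρ`.
  | ⟨L, hL⟩ => hL ▸
    { lam := fun g => (L.toFunctor.obj (Discrete.mk g)).lam
      equivariant := fun g h => mu_lam L (Discrete.mk g) (Discrete.mk h) }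

lemma obj_eq {ρ : CatAction G C} (L : ρ.Lift A) (g : G) :
    L.lift.toFunctor.obj (Discrete.mk g) = ⟨ρ.aut g, L.toEquivariantAlgebra.lam g⟩ := by
  obtain ⟨L, rfl⟩ := L
  rfl

lemma ext_lift {ρ : CatAction G C} {L L' : ρ.Lift A} (h : L.lift = L'.lift) : L = L' := by
  cases L
  cases L'
  congr

/-- Lifts of an action are the same as equivariant algebra structures. -/
def equivEquivariantAlgebra (ρ : CatAction G C) (A : C) [MonObj A] :
    ρ.Lift A ≃ ρ.EquivariantAlgebra A where
  toFun := toEquivariantAlgebra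
  invFun := EquivariantAlgebra.toLift
  left_inv := by
    rintro ⟨L, rfl⟩
    apply ext_lift
    -- The rebuilt functor has the same objects and morphisms as `L`, whose values are pairs
    -- assembled from their own components. Only the constraints are left, and morphisms of pairs
    -- are equal when their underlying ones are.
    refine StrongMonoidalFunctor.ext_of_lax (F := L.toFunctor) _ L.monoidal ?_ ?_
    · exact AutPair.hom_ext (Category.id_comp _)
    · exact fun X Y => AutPair.hom_ext (Category.id_comp _)
  right_inv l := by
    apply EquivariantAlgebra.ext_lam
    intro g
    -- The transport in `toEquivariantAlgebra` is bypassed by comparing the pairs at `g` and reading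
    -- off their second components.
    have h := obj_eq l.toLift g
    change (⟨ρ.aut g, l.lam g⟩ : AutPair A) = _ at h
    injection h with _ h
    exact h.symm

end Lift
end CatAction
end Lifts

/-! ### The induced action on local modules. -/

section Induced

variable {C : Type u} [Category.{v} C] [Preadditive C] [Linear ℂ C] [MonoidalCategory C]
  [MonoidalPreadditive C] [MonoidalLinear ℂ C]
  [BraidedCategory C] [HasCoequalizers C]
  [∀ Z : C, PreservesColimitsOfShape WalkingParallelPair (tensorLeft Z)]
  {A : C} [MonObj A] [IsCommMonObj A] {G : Type w} [Group G]

/-- The composite of the lift attached to an equivariant algebra structure with a twisting functor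
is the induced action. -/
noncomputable def TwistFunctorData.induced
    {F : StrongMonoidalFunctor (AutPair A) (AutBr (LocMod A))} (d : TwistFunctorData F)
    {ρ : CatAction G C} (l : ρ.EquivariantAlgebra A) :
    InducedActionData ρ l (l.toLift.lift.comp F) where
  tw g := d.tw (l.liftFunctor.obj (Discrete.mk g))
  tensor g h M := by
    let X := Discrete.mk g
    let Y := Discrete.mk h
    have t := d.tensor (l.liftFunctor.obj X) (l.liftFunctor.obj Y) M
    have m := d.map (l.toLift.lift.tensorator X Y) M
    change ((AutBr.app (F.tensorator _ _) M).hom.hom ≫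
      (AutBr.app (F.toFunctor.map (l.toLift.lift.tensorator X Y)) M).hom.hom) ≫ _ = _
    -- The tensorator of a composite is that of `F` followed by `F` of the tensorator of the lift.
    -- The second factor becomes `ρ.mu` by the description of `F` on morphisms, the first is
    -- governed by the description of the tensorator of `F`.
    refine (Category.assoc _ _ _).trans ((congrArg (_ ≫ ·) m).trans ?_)
    refine (Category.assoc _ _ _).symm.trans ((congrArg (· ≫ _) t).trans ?_)
    exact Category.assoc _ _ _
  unit M := by
    have t := d.unit M
    have m := d.map l.toLift.lift.unit M
    change ((AutBr.app F.unit M).hom.hom ≫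
      (AutBr.app (F.toFunctor.map l.toLift.lift.unit) M).hom.hom) ≫ _ = _
    refine (Category.assoc _ _ _).trans ((congrArg (_ ≫ ·) m).trans ?_)
    refine (Category.assoc _ _ _).symm.trans ((congrArg (· ≫ _) t).trans ?_)
    exact Category.id_comp _

end Induced
end Condensation

theorem theoremA {C : Type u} [Category.{v} C] [Abelian C] [Linear ℂ C] [MonoidalCategory C]
    [MonoidalPreadditive C] [MonoidalLinear ℂ C] [RigidCategory C] [BraidedCategory C]
    (hC : IsFusion C) (hnd : IsNondegenerate C)
    (A : C) [MonObj A] [IsCommMonObj A] (hsep : IsSeparableAlgebra A)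
    (hconn : IsConnectedAlgebra A) :
    (∀ (p : AutPair A) (M : RMod A), M.IsLocal → ((twist p).obj M).IsLocal) ∧
    ∃ (F : StrongMonoidalFunctor (AutPair A) (AutBr (LocMod A))) (_ : TwistFunctorData F),
      ∀ (G : Type w) [Group G] (ρ : CatAction G C), (∀ g : G, Stab A (ρ.aut g)) →
        ∃ Φ : ρ.Lift A ≃ ρ.EquivariantAlgebra A,
          (∀ (L : ρ.Lift A) (g : G),
            L.lift.toFunctor.obj (Discrete.mk g) = ⟨ρ.aut g, (Φ L).lam g⟩) ∧
          ∀ l : ρ.EquivariantAlgebra A, ∃ σ : CatAction G (LocMod A),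
            σ = (Φ.symm l).lift.comp F ∧ Nonempty (InducedActionData ρ l σ) := by
  -- The action `σ` is by definition the composite of the lift with `F`, so its equation is
  -- reflexive and only its identification with twisting carries content.
  refine ⟨fun p M hM => (isLocal_twistObj_iff p M).2 hM, twistStrong A, twistFunctorData A,
    fun G _ ρ _ => ⟨CatAction.Lift.equivEquivariantAlgebra ρ A, CatAction.Lift.obj_eq,
      fun l => ⟨_, rfl, ⟨(twistFunctorData A).induced l⟩⟩⟩⟩
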